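/- **Notation.** $(a)_n=a(a+1)\cdots(a+n-1)$ is the shifted factorial, and $1/\Gamma(-m)=0$ for $m\in\mathbb Z_{\ge 0}$. For $n\in\mathbb Z_{\ge 0}$, the continuous dual Hahn polynomial is $$S_n(y;a,b,c)=(a+b)_n(a+c)_n\,{}_3F_2\!\left(\begin{matrix}-n,\ a+ix,\ a-ix\\ a+b,\ a+c\end{matrix};1\right),\qquad x^2=y,$$ which is a polynomial in $y,a,b,c$ (denominators are cancelled, so $a+b$ and $a+c$ may be non-positive integers), and the Meixner polynomial is $M_n(x;\beta,c)={}_2F_1(-n,-x;\beta;1-\tfrac1c)$. The function ${}_2F_1(a,b;\gamma;z)/\Gamma(\gamma)$ denotes the analytic continuation to $z\in\mathbb C\setminus[1,\infty)$ of $\sum_{n\ge0}\frac{(a)_n(b)_n}{\Gamma(\gamma+n)\,n!}z^n$; it is defined for all $\gamma\in\mathbb C$. **Theorem.** Let $0<k_1\le k_2$ and $0<c<1$ be real, let $x_1,x_2\in\mathbb Z_{\ge0}$, $p\in\mathbb Z$ and $y\in\mathbb C$, and let $\sqrt y$ be either square root of $y$. Then $$S_{x_2}\bigl(y;k_2-k_1+\tfrac12,\,k_1+k_2-\tfrac12,\,k_1-k_2+x_1-x_2+\tfrac12\bigr)\;\frac{1}{\Gamma(p+x_2-x_1+1)}\;{}_2F_1\!\left(\begin{matrix}p+k_1-k_2+\tfrac12+i\sqrt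 y,\ \ p+k_1-k_2+\tfrac12-i\sqrt y\\ p+x_2-x_1+1\end{matrix};\frac{c}{c-1}\right)$$ $$=\sum_{n=0}^\infty C_n\,S_n\bigl(y;k_2-k_1+\tfrac12,\,k_1+k_2-\tfrac12,\,k_1-k_2+p+\tfrac12\bigr)\,M_{n+p}(x_1;2k_1,c)\,M_n(x_2;2k_2,c),$$ where the series converges absolutely and $$C_n=(-1)^{x_1+x_2}\,\frac{c^{\,n+x_1}(1-c)^{2k_1+p}\,(2k_1)_{x_1}(2k_2)_{x_2}}{\Gamma(n+1)\,\Gamma(n+p+1)};$$ for $n+p<0$ one has $C_n=0$, and the $n$-th term is zero. -/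

import Mathlib

open Topology

namespace BilinearMeixner

/-- The shifted factorial `(a)_n = a (a+1) ⋯ (a+n-1)`. -/
noncomputable def poch (a : ℂ) (n : ℕ) : ℂ := (ascPochhammer ℂ n).eval a

/-- The continuous dual Hahn polynomial `S_n(y; a, b, c)`, that is,
`(a+b)_n (a+c)_n ₃F₂(-n, a+ix, a-ix; a+b, a+c; 1)` with `x² = y`, as a polynomial in `y` and in the
parameters: the denominators of the `k`-th term are cancelled,
`(a+b)_n / (a+b)_k = (a+b+k)_{n-k}` (same for `c`), and
`(a+ix)_k (a-ix)_k = ∏_{j<k} ((a+j)² + y)`. So it has a value also when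
`a+b` or `a+c` is a non-positive integer. -/
noncomputable def contDualHahn (n : ℕ) (y a b c : ℂ) : ℂ :=
  ∑ k ∈ Finset.range (n + 1),
    poch (-(n : ℂ)) k * (∏ j ∈ Finset.range k, ((a + (j : ℂ)) ^ 2 + y)) / (k.factorial : ℂ)
      * poch (a + b + k) (n - k) * poch (a + c + k) (n - k)

theorem contDualHahn_eq (n : ℕ) (y x a b c : ℂ) (hx : x ^ 2 = y)
    (hb : poch (a + b) n ≠ 0) (hc : poch (a + c) n ≠ 0) :
    contDualHahn n y a b c = poch (a + b) n * poch (a + c) n *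
      ∑ k ∈ Finset.range (n + 1),
        poch (-(n : ℂ)) k * poch (a + Complex.I * x) k * poch (a - Complex.I * x) k
          / (poch (a + b) k * poch (a + c) k * (k.factorial : ℂ)) := by
  have split : ∀ (u : ℂ) (k : ℕ), k ≤ n → poch u n = poch u k * poch (u + k) (n - k) := by
    intro u k hkn
    obtain ⟨m, rfl⟩ := Nat.exists_eq_add_of_le hkn
    simp [poch, ← ascPochhammer_mul]
  have pr : ∀ k : ℕ, (∏ j ∈ Finset.range k, ((a + (j : ℂ)) ^ 2 + y))
      = poch (a + Complex.I * x) k * poch (a - Complex.I * x) k := by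
    intro k
    induction k with
    | zero => simp [poch]
    | succ k ih =>
      rw [Finset.prod_range_succ, ih]
      simp only [poch, ascPochhammer_succ_eval]
      linear_combination (-(Polynomial.eval (a + Complex.I * x) (ascPochhammer ℂ k) *
        Polynomial.eval (a - Complex.I * x) (ascPochhammer ℂ k))) * hx +
        (Polynomial.eval (a + Complex.I * x) (ascPochhammer ℂ k) *
        Polynomial.eval (a - Complex.I * x) (ascPochhammer ℂ k)) * x ^ 2 * Complex.I_sq
  rw [contDualHahn, Finset.mul_sum]
  refine Finset.sum_congr rfl fun k hk => ?_
  have hkn : k ≤ n := Nat.lt_succ_iff.mp (Finset.mem_range.mp hk)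
  rw [pr, split (a + b) k hkn, split (a + c) k hkn]
  rw [split (a + b) k hkn] at hb
  rw [split (a + c) k hkn] at hc
  have h1 := left_ne_zero_of_mul hb
  have h2 := left_ne_zero_of_mul hc
  field_simp

/-- The Meixner polynomial `M_n(x; β, c) = ₂F₁(-n, -x; β; 1 - 1/c)`. -/
noncomputable def meixner (n : ℕ) (x β c : ℂ) : ℂ :=
  ∑ k ∈ Finset.range (n + 1),
    poch (-(n : ℂ)) k * poch (-x) k / (poch β k * (k.factorial : ℂ)) * (1 - 1 / c) ^ k

/-- The regularized hypergeometric series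
`∑ₙ (a)_n (b)_n / (Γ(g+n) n!) zⁿ`, which is `₂F₁(a, b; g; z) / Γ(g)`, extended to all `g`
(`1/Γ` is zero at the poles of `Γ`). It converges for `|z| < 1`. -/
noncomputable def hypSeriesReg (a b g z : ℂ) : ℂ :=
  ∑' n : ℕ, poch a n * poch b n * (Complex.Gamma (g + n))⁻¹ / (n.factorial : ℂ) * z ^ n

theorem hypSeriesReg_eq (a b g z : ℂ) (hg : ∀ m : ℕ, g ≠ -m) :
    hypSeriesReg a b g z = ordinaryHypergeometric a b g z / Complex.Gamma g := by
  have hG : ∀ n : ℕ, Complex.Gamma (g + n) = poch g n * Complex.Gamma g := by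
    intro n
    induction n with
    | zero => simp [poch]
    | succ n ih =>
      have : g + n ≠ 0 := fun h => hg n (eq_neg_of_add_eq_zero_left h)
      rw [Nat.cast_succ, ← add_assoc, Complex.Gamma_add_one _ this, ih]
      simp only [poch, ascPochhammer_succ_eval]
      ring
  rw [ordinaryHypergeometric_eq_tsum, div_eq_mul_inv, ← tsum_mul_right]
  refine tsum_congr fun n => ?_
  rw [hG, smul_eq_mul, mul_inv]
  simp only [poch]
  ring

/-- `w` is the value at `z` of the analytic continuation of the germ of `f` at `0` along the segment
from `0` to `z`: there is a holomorphic function on an open set star-shaped about `0` and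
containing `z` which agrees with `f` near `0` and has the value `w` at `z`. -/
def IsStarContinuation (f : ℂ → ℂ) (z w : ℂ) : Prop :=
  ∃ (U : Set ℂ) (F : ℂ → ℂ), IsOpen U ∧ StarConvex ℝ 0 U ∧ z ∈ U ∧ DifferentiableOn ℂ F U ∧
    F =ᶠ[𝓝 0] f ∧ F z = w

theorem IsStarContinuation.unique {f : ℂ → ℂ} {z w₁ w₂ : ℂ} (h₁ : IsStarContinuation f z w₁)
    (h₂ : IsStarContinuation f z w₂) : w₁ = w₂ := by
  obtain ⟨U, F, hU, sU, zU, dF, eF, rfl⟩ := h₁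
  obtain ⟨V, G, hV, sV, zV, dG, eG, rfl⟩ := h₂
  have hS : StarConvex ℝ 0 (U ∩ V) := sU.inter sV
  have hO : IsOpen (U ∩ V) := hU.inter hV
  have hne : (U ∩ V).Nonempty := ⟨z, zU, zV⟩
  have aF : AnalyticOnNhd ℂ F (U ∩ V) := (dF.mono Set.inter_subset_left).analyticOnNhd hO
  have aG : AnalyticOnNhd ℂ G (U ∩ V) := (dG.mono Set.inter_subset_right).analyticOnNhd hO
  exact aF.eqOn_of_preconnected_of_eventuallyEq aG
    (hS.isPathConnected (hS.mem hne)).isConnected.isPreconnected (hS.mem hne) (eF.trans eG.symm) ⟨zU, zV⟩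

open Classical in
/-- The analytic continuation of the germ of `f` at `0` to its star about `0`. -/
noncomputable def starContinuation (f : ℂ → ℂ) (z : ℂ) : ℂ :=
  if h : ∃ w, IsStarContinuation f z w then h.choose else 0

theorem IsStarContinuation.eq {f : ℂ → ℂ} {z w : ℂ} (h : IsStarContinuation f z w) :
    starContinuation f z = w := by
  have h' : ∃ w, IsStarContinuation f z w := ⟨w, h⟩
  rw [starContinuation, dif_pos h']
  exact h'.choose_spec.unique h

/-- The function `₂F₁(a, b; g; z) / Γ(g)`, analytically continued in `z` along rays from `0`
(so to `ℂ ∖ [1, ∞)`), and extended to all `g`. -/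
noncomputable def hypReg (a b g z : ℂ) : ℂ := starContinuation (hypSeriesReg a b g) z

/-- The coefficient `C_n`. By the conventions `Γ(-m) = 0` and `t / 0 = 0` it is zero if
`n + p < 0`, in accordance with `1/Γ(-m) = 0`. -/
noncomputable def coeffC (k₁ k₂ c : ℝ) (x₁ x₂ : ℕ) (p : ℤ) (n : ℕ) : ℂ :=
  (-1) ^ (x₁ + x₂) * (c : ℂ) ^ (n + x₁) * (((1 - c) ^ (2 * k₁ + (p : ℝ)) : ℝ) : ℂ)
    * poch (2 * k₁) x₁ * poch (2 * k₂) x₂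
    / (Complex.Gamma ((n : ℂ) + 1) * Complex.Gamma ((n : ℂ) + (p : ℂ) + 1))

end BilinearMeixner

/-!
Write `a = k₂ - k₁ + 1/2`, `b = k₁ + k₂ - 1/2`, `e = k₁ - k₂ + p + 1/2`, `β₁ = 2k₁`, `β₂ = 2k₂`, so
that `a + b = β₂`, `a + e = p + 1` and `b + e = β₁ + p`. The argument treats `x₁` and `x₂` as the
variables: both sides satisfy the same recurrence along the diagonals `x₁ - x₂ = const`.

*The recurrence.* On the left, the hypergeometric factor depends only on `x₂ - x₁`, and on a diagonal
the parameters of `S_{x₂}` are constant, so the recurrence is the three-term recurrence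
`contDualHahn_rec` in the degree. On the right, the three-term recurrence of `S_n` in `n` is moved to
the product `M_{n+p}(x₁) M_n(x₂)` by summation by parts, and `meixner_mul_meixner` turns the
resulting operator in the degrees into one in `x₁, x₂`. That identity expresses that the Casimir
element acts in the same way on both sides of the `su(1,1)` duality; it is proved by writing all
neighbours of a Meixner polynomial in terms of two functions (`meixner_neighbours`). The outcome is
`bilinTerm_succ`. The term with `(x₁ - 1, x₂ - 1)` has the factor `x₁ x₂`, so only the values
for `x₁ = 0` or `x₂ = 0` are needed to start.

*The boundary.* For `x₂ = 0` (`hasSum_genCoeff_mul_meixner_left`) and for `x₁ = 0`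
(`hasSum_genCoeff_mul_meixner_right`) the sum is reduced to `x₁ = x₂ = 0` with a shifted parameter
`a`, by contiguous relations that change `β` together with `a` and leave a telescoping series.

*The generating function.* There remains
`∑ c^n S_n(y; a, b, e) / (n! Γ(a+e+n)) = (1-c)^(-b-e) ₂F₁(e+is, e-is; a+e; c/(c-1)) / Γ(a+e)`
(`hypReg_eq_tsum_genCoeff`). For small `c` it is a rearrangement of a double series, after `S_n` has
been rewritten with `e` as distinguished parameter (`contDualHahn_symm`). The left-hand side
is holomorphic in the unit disc, hence provides the analytic continuation of the right-hand side.

All convergence comes from the fact that `S_n / (n! Γ(a+e+n))` and `M_n` grow subexponentially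
in `n`. For the former, this is because the limiting characteristic polynomial of the three-term
recurrence is `(X - 1) ^ 2` (`SubExp.of_recurrence`).
-/

namespace BilinearMeixner

/-! ### Continuous dual Hahn polynomials -/

theorem poch_zero (a : ℂ) : poch a 0 = 1 := by simp [poch]

theorem poch_succ (a : ℂ) (n : ℕ) : poch a (n + 1) = poch a n * (a + n) := by
  simp [poch, ascPochhammer_succ_eval]

theorem poch_succ_left (a : ℂ) (n : ℕ) : poch a (n + 1) = a * poch (a + 1) n := by
  induction n with
  | zero => simp [poch_succ, poch_zero]
  | succ n ih =>
    rw [poch_succ, ih, poch_succ]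
    push_cast
    ring

theorem poch_neg_natCast (n k : ℕ) :
    poch (-(n : ℂ)) k = (-1) ^ k * (n.choose k : ℂ) * (k.factorial : ℂ) := by
  induction k with
  | zero => simp [poch_zero]
  | succ k ih =>
    rw [poch_succ, ih, Nat.factorial_succ, pow_succ]
    have h : (n.choose (k + 1) : ℂ) * (k + 1) = n.choose k * ((n : ℂ) - k) := by
      rcases le_or_gt k n with hk | hk
      · have := Nat.choose_succ_right_eq n k
        rw [← Nat.cast_sub hk]
        exact_mod_cast this
      · simp [Nat.choose_eq_zero_of_lt hk, Nat.choose_eq_zero_of_lt (Nat.lt_succ_of_lt hk)]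
    push_cast
    linear_combination ((-1) ^ k * (k.factorial : ℂ)) * h

/-- The product `(a + i s)_k (a - i s)_k` with `s ^ 2 = y`, written as a polynomial in `y`. -/
noncomputable def wilsonProd (a y : ℂ) (k : ℕ) : ℂ := ∏ j ∈ Finset.range k, ((a + (j : ℂ)) ^ 2 + y)

theorem wilsonProd_zero (a y : ℂ) : wilsonProd a y 0 = 1 := by simp [wilsonProd]

theorem wilsonProd_succ (a y : ℂ) (k : ℕ) :
    wilsonProd a y (k + 1) = wilsonProd a y k * ((a + k) ^ 2 + y) := by
  simp [wilsonProd, Finset.prod_range_succ]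

theorem wilsonProd_succ_left (a y : ℂ) (k : ℕ) :
    wilsonProd a y (k + 1) = (a ^ 2 + y) * wilsonProd (a + 1) y k := by
  rw [wilsonProd, Finset.prod_range_succ', wilsonProd, mul_comm]
  congr 1
  · simp
  · refine Finset.prod_congr rfl fun j _ => ?_
    push_cast
    ring

theorem wilsonProd_eq_poch (a s : ℂ) (k : ℕ) :
    wilsonProd a (s ^ 2) k = poch (a + Complex.I * s) k * poch (a - Complex.I * s) k := by
  induction k with
  | zero => simp [wilsonProd_zero, poch_zero]
  | succ k ih =>
    rw [wilsonProd_succ, ih, poch_succ, poch_succ]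
    linear_combination (poch (a + Complex.I * s) k * poch (a - Complex.I * s) k) * s ^ 2
      * Complex.I_sq

theorem contDualHahn_eq_sum (n : ℕ) (y a b e : ℂ) :
    contDualHahn n y a b e = ∑ k ∈ Finset.range (n + 1), (-1) ^ k * (n.choose k : ℂ)
      * wilsonProd a y k * poch (a + b + k) (n - k) * poch (a + e + k) (n - k) := by
  refine Finset.sum_congr rfl fun k _ => ?_
  rw [poch_neg_natCast, wilsonProd]
  have : (k.factorial : ℂ) ≠ 0 := by exact_mod_cast k.factorial_ne_zero
  field_simp

theorem contDualHahn_zero (y a b e : ℂ) : contDualHahn 0 y a b e = 1 := by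
  simp [contDualHahn_eq_sum, wilsonProd_zero, poch_zero]

/-- Raising the distinguished parameter `a` of the defining sum. -/
theorem contDualHahn_raise (n : ℕ) (y a b e : ℂ) :
    (n + a + b) * (n + a + e) * contDualHahn n y a b e - contDualHahn (n + 1) y a b e
      = (a ^ 2 + y) * contDualHahn n y (a + 1) b e := by
  have h1 : contDualHahn n y a b e = ∑ k ∈ Finset.range (n + 1 + 1), (-1) ^ k * (n.choose k : ℂ)
      * wilsonProd a y k * poch (a + b + k) (n - k) * poch (a + e + k) (n - k) := by
    rw [Finset.sum_range_succ _ (n + 1), contDualHahn_eq_sum]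
    simp
  rw [h1, contDualHahn_eq_sum (n + 1), contDualHahn_eq_sum n y (a + 1), Finset.mul_sum,
    Finset.mul_sum, ← Finset.sum_sub_distrib, Finset.sum_range_succ' _ (n + 1)]
  have h0 : ((n : ℂ) + a + b) * (n + a + e) * ((-1) ^ 0 * (n.choose 0 : ℂ)
      * wilsonProd a y 0 * poch (a + b + (0 : ℕ)) (n - 0) * poch (a + e + (0 : ℕ)) (n - 0))
      - (-1) ^ 0 * ((n + 1).choose 0 : ℂ)
      * wilsonProd a y 0 * poch (a + b + (0 : ℕ)) (n + 1 - 0) * poch (a + e + (0 : ℕ)) (n + 1 - 0)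
      = 0 := by
    simp only [Nat.sub_zero, poch_succ, Nat.choose_zero_right, Nat.cast_zero, add_zero]
    push_cast
    ring
  rw [h0, add_zero]
  refine Finset.sum_congr rfl fun k hk => ?_
  obtain ⟨m, rfl⟩ := Nat.exists_eq_add_of_le (Nat.lt_succ_iff.mp (Finset.mem_range.mp hk))
  have e1 : k + m + 1 - (k + 1) = m := by omega
  have e2 : k + m - k = m := by omega
  rw [e1, e2, wilsonProd_succ_left, Nat.choose_succ_succ']
  have c1 : a + 1 + b + (k : ℂ) = a + b + ((k + 1 : ℕ) : ℂ) := by push_cast; ring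
  have c2 : a + 1 + e + (k : ℂ) = a + e + ((k + 1 : ℕ) : ℂ) := by push_cast; ring
  rw [c1, c2]
  rcases m with _ | m
  · simp [poch_zero]
    ring
  · have e3 : k + (m + 1) - (k + 1) = m := by omega
    rw [e3, poch_succ, poch_succ, pow_succ]
    push_cast
    ring

/-- Raising a parameter that is not the distinguished one of the defining sum. -/
theorem contDualHahn_raise_last (n : ℕ) (y e b a : ℂ) :
    contDualHahn (n + 1) y e b (a + 1) - contDualHahn (n + 1) y e b a
      = (n + 1) * (b + e + n) * contDualHahn n y e b (a + 1) := by
  rw [contDualHahn_eq_sum (n + 1), contDualHahn_eq_sum (n + 1), contDualHahn_eq_sum n,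
    ← Finset.sum_sub_distrib, Finset.sum_range_succ, Finset.mul_sum]
  simp only [Nat.sub_self, poch_zero, sub_self, add_zero]
  refine Finset.sum_congr rfl fun k hk => ?_
  obtain ⟨m, rfl⟩ := Nat.exists_eq_add_of_le (Nat.lt_succ_iff.mp (Finset.mem_range.mp hk))
  have e1 : k + m + 1 - k = m + 1 := by omega
  have e2 : k + m - k = m := by omega
  have hc : ((k + m + 1).choose k : ℂ) * (m + 1) = (k + m + 1) * ((k + m).choose k : ℂ) := by
    have := Nat.choose_mul_succ_eq (k + m) k
    rw [e1] at this
    have h2 : ((k + m).choose k : ℂ) * (k + m + 1) = ((k + m + 1).choose k : ℂ) * (m + 1) := by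
      exact_mod_cast this
    linear_combination -h2
  have c1 : e + (a + 1) + (k : ℂ) = e + a + k + 1 := by ring
  rw [e1, e2, c1, poch_succ_left (e + a + k), poch_succ (e + a + k + 1), poch_succ]
  push_cast
  linear_combination ((-1) ^ k * wilsonProd e y k * poch (e + b + k) m * (e + b + k + m) *
    poch (e + a + k + 1) m) * hc

/-- At `n + 2`, the three-term recurrence follows from the symmetry in the degrees `n` and `n + 1`:
that symmetry lets the two contiguous relations, which shift `a` in different positions, be
combined. -/
theorem contDualHahn_rec_of_symm (n : ℕ) (y : ℂ)
    (h0 : ∀ a b e, contDualHahn n y a b e = contDualHahn n y e b a)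
    (h1 : ∀ a b e, contDualHahn (n + 1) y a b e = contDualHahn (n + 1) y e b a) (a b e : ℂ) :
    contDualHahn (n + 2) y a b e =
      ((n + 1 + a + b) * (n + 1 + a + e) + (n + 1) * (n + b + e) - a ^ 2 - y)
          * contDualHahn (n + 1) y a b e
        - (n + 1) * (n + b + e) * (n + a + b) * (n + a + e) * contDualHahn n y a b e := by
  have A0 := contDualHahn_raise n y a b e
  have A1 := contDualHahn_raise (n + 1) y a b e
  have B := contDualHahn_raise_last n y e b a
  rw [h1 e b (a + 1), h1 e b a, h0 e b (a + 1)] at B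
  push_cast at A1
  linear_combination -A1 - (a ^ 2 + y) * B + (n + 1) * (b + e + n) * A0

/-- The symmetry that exchanges the distinguished parameter of the defining sum with the last one
(a form of Sheppard's transformation): the coefficients of the three-term recurrence are
symmetric. -/
theorem contDualHahn_symm (n : ℕ) (y a b e : ℂ) :
    contDualHahn n y a b e = contDualHahn n y e b a := by
  suffices h : ∀ n, (∀ a b e, contDualHahn n y a b e = contDualHahn n y e b a) ∧
      (∀ a b e, contDualHahn (n + 1) y a b e = contDualHahn (n + 1) y e b a) from (h n).1 a b e
  intro n
  induction n with
  | zero =>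
    refine ⟨fun a b e => by rw [contDualHahn_zero, contDualHahn_zero], fun a b e => ?_⟩
    have h := contDualHahn_raise 0 y a b e
    have h' := contDualHahn_raise 0 y e b a
    simp only [contDualHahn_zero] at h h'
    push_cast at h h'
    linear_combination h' - h
  | succ n ih =>
    refine ⟨ih.2, fun a b e => ?_⟩
    rw [contDualHahn_rec_of_symm n y ih.1 ih.2, contDualHahn_rec_of_symm n y ih.1 ih.2 e b a,
      ih.1 e b a, ih.2 e b a]
    ring

/-- The three-term recurrence. For `n = 0` the coefficient of the last term vanishes. -/
theorem contDualHahn_rec (n : ℕ) (y a b e : ℂ) :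
    contDualHahn (n + 1) y a b e =
      ((n + a + b) * (n + a + e) + n * (n + b + e - 1) - a ^ 2 - y) * contDualHahn n y a b e
        - n * (n + b + e - 1) * (n + a + b - 1) * (n + a + e - 1)
          * contDualHahn (n - 1) y a b e := by
  rcases n with _ | n
  · have h := contDualHahn_raise 0 y a b e
    simp only [contDualHahn_zero] at h ⊢
    push_cast at h ⊢
    linear_combination -h
  · rw [contDualHahn_rec_of_symm n y (contDualHahn_symm n y) (contDualHahn_symm (n + 1) y),
      Nat.add_sub_cancel]
    push_cast
    ring

/-! ### Meixner polynomials -/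

theorem poch_ne_zero {β : ℂ} (hβ : 0 < β.re) (n : ℕ) : poch β n ≠ 0 := by
  induction n with
  | zero => simp [poch_zero]
  | succ n ih =>
    rw [poch_succ]
    refine mul_ne_zero ih fun h => ?_
    have := congrArg Complex.re h
    simp at this
    have hn : (0 : ℝ) ≤ n := n.cast_nonneg
    linarith

/-- On the natural numbers, the Meixner polynomial is a sum that is symmetric in the degree and the
variable; any range that contains `{0, …, n}` may be taken. -/
theorem meixner_eq_sum (n x : ℕ) (β c : ℂ) {K : ℕ} (hK : n < K) :
    meixner n x β c = ∑ k ∈ Finset.range K, (n.choose k : ℂ) * (x.choose k : ℂ)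
      * (k.factorial : ℂ) / poch β k * (1 - 1 / c) ^ k := by
  have hsub : Finset.range (n + 1) ⊆ Finset.range K := Finset.range_subset_range.2 hK
  rw [← Finset.sum_subset hsub, meixner]
  · refine Finset.sum_congr rfl fun k _ => ?_
    rw [poch_neg_natCast, poch_neg_natCast]
    have h1 : (k.factorial : ℂ) ≠ 0 := by exact_mod_cast k.factorial_ne_zero
    have h2 : ((-1 : ℂ) ^ k) * (-1) ^ k = 1 := by rw [← mul_pow]; simp
    rw [mul_comm (poch β k), ← div_div]
    congr 2
    field_simp
    linear_combination (n.choose k : ℂ) * x.choose k * h2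
  · intro k _ hk
    rw [Finset.mem_range, not_lt] at hk
    simp [Nat.choose_eq_zero_of_lt hk]

/-- Self-duality of the Meixner polynomials. -/
theorem meixner_dual (n x : ℕ) (β c : ℂ) : meixner n x β c = meixner x n β c := by
  rw [meixner_eq_sum n x β c (Nat.lt_succ_of_le (le_max_left n x)),
    meixner_eq_sum x n β c (Nat.lt_succ_of_le (le_max_right n x))]
  refine Finset.sum_congr rfl fun k _ => ?_
  ring

theorem meixner_zero_right (n : ℕ) (β c : ℂ) : meixner n (0 : ℕ) β c = 1 := by
  rw [meixner_dual]
  simp [meixner, poch_zero]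

theorem choose_pred_mul (n k : ℕ) :
    (n : ℂ) * ((n - 1).choose k : ℂ) = (n.choose k : ℂ) * ((n : ℂ) - k) := by
  rcases n with _ | n
  · rcases k with _ | k <;> simp
  · have h := Nat.choose_mul_succ_eq n k
    rw [Nat.add_sub_cancel]
    rcases le_or_gt k (n + 1) with hk | hk
    · have h2 : ((n.choose k * (n + 1) : ℕ) : ℂ) = ((n + 1).choose k * (n + 1 - k) : ℕ) := by
        rw [h]
      rw [Nat.cast_mul, Nat.cast_mul, Nat.cast_sub hk] at h2
      linear_combination h2
    · simp [Nat.choose_eq_zero_of_lt hk, Nat.choose_eq_zero_of_lt (Nat.lt_of_succ_lt hk)]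

/-- Lowering `β + 1` to `β`. -/
theorem meixner_lower (n x : ℕ) {β : ℂ} (hβ : 0 < β.re) (c : ℂ) :
    β * meixner n x β c
      = (β + n) * meixner n x (β + 1) c - n * meixner (n - 1) x (β + 1) c := by
  rw [meixner_eq_sum n x β c (Nat.lt_succ_self n), meixner_eq_sum n x _ c (Nat.lt_succ_self n),
    meixner_eq_sum (n - 1) x _ c (Nat.lt_succ_of_le (Nat.sub_le n 1)), Finset.mul_sum,
    Finset.mul_sum, Finset.mul_sum, ← Finset.sum_sub_distrib]
  refine Finset.sum_congr rfl fun k _ => ?_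
  have h1 := poch_ne_zero hβ k
  have h2 : poch (β + 1) k ≠ 0 := poch_ne_zero (by simp; linarith) k
  have h3 : poch β k * (β + k) = β * poch (β + 1) k := by rw [← poch_succ, poch_succ_left]
  have h4 := choose_pred_mul n k
  generalize 1 - 1 / c = w
  field_simp
  linear_combination (x.choose k : ℂ) * k.factorial * w ^ k *
    ((-(n.choose k : ℂ)) * h3 + poch β k * h4)

/-- The forward shift in the variable `x`. -/
theorem meixner_add_one_sub (n x : ℕ) {β : ℂ} (hβ : 0 < β.re) (c : ℂ) :
    β * (meixner n (x + 1 : ℕ) β c - meixner n x β c)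
      = n * (1 - 1 / c) * meixner (n - 1) x (β + 1) c := by
  have hβ0 : β ≠ 0 := fun h => by simp [h] at hβ
  rw [meixner_eq_sum n x β c (K := n + 2) (by omega), meixner_eq_sum n _ _ c (K := n + 2) (by omega),
    meixner_eq_sum (n - 1) x _ c (K := n + 1) (by omega), ← Finset.sum_sub_distrib,
    Finset.sum_range_succ', Finset.mul_sum]
  simp only [Nat.choose_zero_right, sub_self, add_zero]
  rw [Finset.mul_sum]
  refine Finset.sum_congr rfl fun k _ => ?_
  have h2 : poch (β + 1) k ≠ 0 := poch_ne_zero (by simp; linarith) k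
  have h4 : (n : ℂ) * ((n - 1).choose k : ℂ) = (n.choose (k + 1) : ℂ) * (k + 1) := by
    rw [choose_pred_mul]
    rcases le_or_gt k n with hk | hk
    · rw [← Nat.cast_sub hk]
      exact_mod_cast (Nat.choose_succ_right_eq n k).symm
    · simp [Nat.choose_eq_zero_of_lt hk, Nat.choose_eq_zero_of_lt (Nat.lt_succ_of_lt hk)]
  rw [poch_succ_left, Nat.choose_succ_succ' x, Nat.factorial_succ, pow_succ]
  generalize 1 - 1 / c = w
  push_cast
  field_simp
  linear_combination (-(x.choose k : ℂ) * k.factorial * w ^ k * w) * h4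

/-- The step in the variable `x`, at the price of raising `β`. -/
theorem meixner_add_one (n x : ℕ) {β : ℂ} (hβ : 0 < β.re) (c : ℂ) :
    β * meixner n (x + 1 : ℕ) β c
      = (β + n) * meixner n x (β + 1) c - n / c * meixner (n - 1) x (β + 1) c := by
  linear_combination meixner_add_one_sub n x hβ c + meixner_lower n x hβ c

/-- All neighbours of `M_n(x; β, c)` in the degree and in the variable are combinations of
`V = M_n(x; β + 1, c)` and `W = n M_{n-1}(x; β + 1, c)`. -/
theorem meixner_neighbours (n x : ℕ) {β : ℂ} (hβ : 0 < β.re) {c : ℂ} (hc : c ≠ 0) :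
    ∃ V W : ℂ, β * meixner n x β c = (β + n) * V - W ∧
      β * meixner n (x + 1 : ℕ) β c = (β + n) * V - W / c ∧
      β * meixner (n + 1) x β c = (β + x) * V - ((x - n) * V + W) / c ∧
      β * (n * meixner (n - 1) x β c) = (β + x) * W - c * ((β + x) * W - n * ((β + n) * V - W)) ∧
      β * (x * meixner n (x - 1 : ℕ) β c) = (β + n) * ((x - n) * V + W)
        - c * ((β + n) * ((x - n) * V + W) - x * ((β + n) * V - W)) := by
  have d1 : ∀ n x : ℕ, β * meixner n x β c
      = (β + x) * meixner n x (β + 1) c - x * meixner n (x - 1 : ℕ) (β + 1) c := by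
    intro n x
    rw [meixner_dual n x β, meixner_dual n x (β + 1), meixner_dual n (x - 1)]
    exact meixner_lower x n hβ c
  have d2 : ∀ n x : ℕ, β * meixner (n + 1) x β c
      = (β + x) * meixner n x (β + 1) c - x / c * meixner n (x - 1 : ℕ) (β + 1) c := by
    intro n x
    rw [meixner_dual (n + 1) x β, meixner_dual n x (β + 1), meixner_dual n (x - 1)]
    exact meixner_add_one x n hβ c
  have g1 := meixner_lower n x hβ c
  have e1 := d1 n x
  have hW : (x : ℂ) * meixner n (x - 1 : ℕ) (β + 1) c = (x - n) * meixner n x (β + 1) c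
      + n * meixner (n - 1) x (β + 1) c := by linear_combination e1 - g1
  refine ⟨meixner n x (β + 1) c, n * meixner (n - 1) x (β + 1) c, g1, ?_, ?_, ?_, ?_⟩
  · rw [meixner_add_one n x hβ c]
    ring
  · rw [d2 n x, ← hW]
    ring
  · rcases n with _ | n
    · simp
    · have a1 := d1 n x
      have a2 := d2 n x
      have a3 : c * (β * meixner (n + 1) x β c) = c * (β + x) * meixner n x (β + 1) c
          - x * meixner n (x - 1 : ℕ) (β + 1) c := by
        rw [a2]; field_simp
      rw [← g1]
      rw [Nat.add_sub_cancel]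
      linear_combination ((n + 1 : ℕ) : ℂ) * (a1 - a3)
  · rcases x with _ | x
    · simp only [Nat.cast_zero, zero_mul, mul_zero, sub_zero] at hW ⊢
      rw [← hW]
      ring
    · have a1 := meixner_lower n x hβ c
      have a2 := meixner_add_one n x hβ c
      have a3 : c * (β * meixner n (x + 1 : ℕ) β c) = c * (β + n) * meixner n x (β + 1) c
          - n * meixner (n - 1) x (β + 1) c := by
        rw [a2]; field_simp
      rw [← g1, ← hW]
      rw [Nat.add_sub_cancel]
      linear_combination ((x + 1 : ℕ) : ℂ) * (a1 - a3)

/-- Infinitesimal form of the invariance of the Casimir element of `su(1,1)`: on products of two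
Meixner polynomials a diagonal three-term operator in the degrees equals one in the variables. -/
theorem meixner_mul_meixner (N n x₁ x₂ : ℕ) {β₁ β₂ : ℂ} (h₁ : 0 < β₁.re) (h₂ : 0 < β₂.re) {c : ℂ}
    (hc : c ≠ 0) :
    ((n + β₂) * (N + 1) + n * (N + β₁ - 1)) * (meixner N x₁ β₁ c * meixner n x₂ β₂ c)
        - n * N / c * (meixner (N - 1) x₁ β₁ c * meixner (n - 1) x₂ β₂ c)
        - c * (N + β₁) * (n + β₂) * (meixner (N + 1) x₁ β₁ c * meixner (n + 1) x₂ β₂ c)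
      = ((x₂ + β₂) * (x₁ + 1) + x₂ * (x₁ + β₁ - 1)) * (meixner N x₁ β₁ c * meixner n x₂ β₂ c)
        - c * (x₁ + β₁) * (x₂ + β₂)
          * (meixner N (x₁ + 1 : ℕ) β₁ c * meixner n (x₂ + 1 : ℕ) β₂ c)
        - x₁ * x₂ / c * (meixner N (x₁ - 1 : ℕ) β₁ c * meixner n (x₂ - 1 : ℕ) β₂ c) := by
  have hβ₁ : β₁ ≠ 0 := fun h => by simp [h] at h₁
  have hβ₂ : β₂ ≠ 0 := fun h => by simp [h] at h₂
  obtain ⟨V, W, a1, a2, a3, a4, a5⟩ := meixner_neighbours N x₁ h₁ hc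
  obtain ⟨V', W', b1, b2, b3, b4, b5⟩ := meixner_neighbours n x₂ h₂ hc
  refine mul_left_cancel₀ (mul_ne_zero hβ₁ hβ₂) ?_
  -- both sides are regrouped into the products that `meixner_neighbours` expresses by `V` and `W`
  have L : ∀ A B C P Q R S T U : ℂ, β₁ * β₂ * (A * (P * Q) - n * N / c * (R * S)
      - c * B * C * (T * U)) = A * ((β₁ * P) * (β₂ * Q)) - 1 / c * ((β₁ * (N * R)) * (β₂ * (n * S)))
      - c * B * C * ((β₁ * T) * (β₂ * U)) := by intros; ring
  have L' : ∀ A B C P Q R S T U : ℂ, β₁ * β₂ * (A * (P * Q) - c * B * C * (T * U)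
      - x₁ * x₂ / c * (R * S)) = A * ((β₁ * P) * (β₂ * Q)) - c * B * C * ((β₁ * T) * (β₂ * U))
      - 1 / c * ((β₁ * (x₁ * R)) * (β₂ * (x₂ * S))) := by intros; ring
  rw [L, L', a1, a2, a3, a4, a5, b1, b2, b3, b4, b5]
  field_simp
  ring

/-! ### Subexponential growth -/

/-- Sequences of subexponential growth: `f n = O(ρ ^ n)` for every `ρ > 1`. -/
def SubExp (f : ℕ → ℂ) : Prop := ∀ ρ : ℝ, 1 < ρ → ∃ K : ℝ, ∀ n, ‖f n‖ ≤ K * ρ ^ n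

theorem SubExp.of_eventually {f : ℕ → ℂ}
    (h : ∀ ρ : ℝ, 1 < ρ → ∃ K : ℝ, ∀ᶠ n in Filter.atTop, ‖f n‖ ≤ K * ρ ^ n) : SubExp f := by
  intro ρ hρ
  obtain ⟨K, hK⟩ := h ρ hρ
  obtain ⟨N, hN⟩ := Filter.eventually_atTop.1 hK
  have hs : 0 ≤ ∑ i ∈ Finset.range N, ‖f i‖ := Finset.sum_nonneg fun i _ => norm_nonneg _
  have h1 : ∀ n, (1 : ℝ) ≤ ρ ^ n := fun n => one_le_pow₀ hρ.le
  refine ⟨|K| + ∑ i ∈ Finset.range N, ‖f i‖, fun n => ?_⟩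
  rcases le_or_gt N n with hn | hn
  · refine (hN n hn).trans ?_
    gcongr
    exact (le_abs_self K).trans (le_add_of_nonneg_right hs)
  · have h2 : ‖f n‖ ≤ ∑ i ∈ Finset.range N, ‖f i‖ :=
      Finset.single_le_sum (f := fun i => ‖f i‖) (fun i _ => norm_nonneg _) (Finset.mem_range.2 hn)
    calc ‖f n‖ ≤ |K| + ∑ i ∈ Finset.range N, ‖f i‖ := by linarith [abs_nonneg K]
      _ ≤ _ := le_mul_of_one_le_right (by positivity) (h1 n)

theorem SubExp.const (a : ℂ) : SubExp fun _ => a := fun _ hρ =>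
  ⟨‖a‖, fun _ => le_mul_of_one_le_right (norm_nonneg _) (one_le_pow₀ hρ.le)⟩

theorem SubExp.add {f g : ℕ → ℂ} (hf : SubExp f) (hg : SubExp g) : SubExp fun n => f n + g n := by
  intro ρ hρ
  obtain ⟨K, hK⟩ := hf ρ hρ
  obtain ⟨L, hL⟩ := hg ρ hρ
  exact ⟨K + L, fun n => (norm_add_le _ _).trans (by rw [add_mul]; exact add_le_add (hK n) (hL n))⟩

theorem SubExp.mul {f g : ℕ → ℂ} (hf : SubExp f) (hg : SubExp g) : SubExp fun n => f n * g n := by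
  intro ρ hρ
  have h1 : 1 < √ρ := by rwa [Real.lt_sqrt zero_le_one, one_pow]
  obtain ⟨K, hK⟩ := hf _ h1
  obtain ⟨L, hL⟩ := hg _ h1
  refine ⟨K * L, fun n => ?_⟩
  rw [norm_mul]
  calc ‖f n‖ * ‖g n‖ ≤ (K * √ρ ^ n) * (L * √ρ ^ n) :=
        mul_le_mul (hK n) (hL n) (norm_nonneg _) ((norm_nonneg _).trans (hK n))
    _ = K * L * (√ρ * √ρ) ^ n := by rw [mul_pow]; ring
    _ = K * L * ρ ^ n := by rw [Real.mul_self_sqrt (by linarith)]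

theorem SubExp.sub {f g : ℕ → ℂ} (hf : SubExp f) (hg : SubExp g) : SubExp fun n => f n - g n := by
  simpa [sub_eq_add_neg] using hf.add ((SubExp.const (-1)).mul hg)

theorem SubExp.comp {f : ℕ → ℂ} (hf : SubExp f) {j : ℕ → ℕ} {d : ℕ} (hj : ∀ n, j n ≤ n + d) :
    SubExp fun n => f (j n) := by
  intro ρ hρ
  obtain ⟨K, hK⟩ := hf ρ hρ
  have hK0 : 0 ≤ K := by simpa using (norm_nonneg _).trans (hK 0)
  refine ⟨K * ρ ^ d, fun n => (hK _).trans ?_⟩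
  rw [mul_assoc, ← pow_add, add_comm d]
  exact mul_le_mul_of_nonneg_left (pow_le_pow_right₀ hρ.le (hj n)) hK0

/-- A sequence of real numbers that eventually grows at most by the factor `ρ` in each step. -/
theorem exists_le_mul_pow {V : ℕ → ℝ} {ρ : ℝ} (hρ : 1 < ρ)
    (h : ∀ᶠ n in Filter.atTop, V (n + 1) ≤ ρ * V n) :
    ∃ K : ℝ, ∀ᶠ n in Filter.atTop, V n ≤ K * ρ ^ n := by
  obtain ⟨N, hN⟩ := Filter.eventually_atTop.1 h
  refine ⟨V N / ρ ^ N, Filter.eventually_atTop.2 ⟨N, fun n hn => ?_⟩⟩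
  induction n, hn using Nat.le_induction with
  | base => rw [div_mul_cancel₀ _ (by positivity)]
  | succ n hn ih =>
    refine (hN n hn).trans ?_
    rw [pow_succ]
    nlinarith

theorem SubExp.of_ratio {f α : ℕ → ℂ} (hα : Filter.Tendsto α Filter.atTop (𝓝 1))
    (h : ∀ᶠ n in Filter.atTop, f (n + 1) = α n * f n) : SubExp f := by
  refine SubExp.of_eventually fun ρ hρ => exists_le_mul_pow (V := fun n => ‖f n‖) hρ ?_
  have h1 : ∀ᶠ n in Filter.atTop, ‖α n‖ < ρ := hα.norm.eventually_lt_const (by simpa using hρ)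
  filter_upwards [h, h1] with n hn hn1
  rw [hn, norm_mul]
  exact mul_le_mul_of_nonneg_right hn1.le (norm_nonneg _)

theorem SubExp.natCast : SubExp fun n => (n : ℂ) := by
  refine SubExp.of_ratio (α := fun n => 1 + 1 / (n : ℂ)) ?_ ?_
  · simpa using tendsto_const_nhds.add (tendsto_one_div_atTop_nhds_zero_nat (𝕜 := ℂ))
  · filter_upwards [Filter.eventually_gt_atTop 0] with n hn
    have : (n : ℂ) ≠ 0 := by exact_mod_cast hn.ne'
    push_cast
    field_simp

/-- A second-order linear recurrence whose limiting characteristic polynomial is `(X - 1) ^ 2`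
has solutions of subexponential growth only. -/
theorem SubExp.of_recurrence {f α γ : ℕ → ℂ} (hα : Filter.Tendsto α Filter.atTop (𝓝 2))
    (hγ : Filter.Tendsto γ Filter.atTop (𝓝 1))
    (h : ∀ᶠ n in Filter.atTop, f (n + 2) = α n * f (n + 1) - γ n * f n) : SubExp f := by
  refine SubExp.of_eventually fun ρ hρ => ?_
  obtain ⟨δ, hδ, hδ1, hδρ⟩ : ∃ δ : ℝ, 0 < δ ∧ δ ≤ 1 ∧ 1 + 3 * δ ≤ ρ :=
    ⟨min 1 ((ρ - 1) / 3), lt_min one_pos (by linarith), min_le_left _ _,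
      by linarith [min_le_right 1 ((ρ - 1) / 3)]⟩
  have h1 : ∀ᶠ n in Filter.atTop, ‖α n - 1 - γ n‖ < δ ^ 2 :=
    ((hα.sub_const 1).sub hγ).norm.eventually_lt_const (by norm_num; positivity)
  have h2 : ∀ᶠ n in Filter.atTop, ‖γ n‖ < 1 + δ ^ 2 :=
    hγ.norm.eventually_lt_const (by simp; positivity)
  -- the Lyapunov function: the increments are weighted more heavily than the values
  obtain ⟨K, hK⟩ := exists_le_mul_pow (V := fun n => δ * ‖f (n + 1)‖ + ‖f (n + 1) - f n‖) hρ (by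
    filter_upwards [h, h1, h2] with n hn hn1 hn2
    have e1 : f (n + 2) - f (n + 1) = (α n - 1 - γ n) * f (n + 1) + γ n * (f (n + 1) - f n) := by
      rw [hn]; ring
    have e2 : ‖f (n + 2) - f (n + 1)‖
        ≤ δ ^ 2 * ‖f (n + 1)‖ + (1 + δ ^ 2) * ‖f (n + 1) - f n‖ := by
      rw [e1]
      refine (norm_add_le _ _).trans ?_
      rw [norm_mul, norm_mul]
      gcongr
    have e3 : ‖f (n + 2)‖ ≤ ‖f (n + 1)‖ + ‖f (n + 2) - f (n + 1)‖ := by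
      have := norm_add_le (f (n + 1)) (f (n + 2) - f (n + 1))
      rwa [add_sub_cancel] at this
    have p1 := norm_nonneg (f (n + 1))
    have p2 := norm_nonneg (f (n + 1) - f n)
    have q1 : δ ^ 2 ≤ δ := by nlinarith
    have q2 : δ * δ ^ 2 ≤ δ ^ 2 := by nlinarith
    calc δ * ‖f (n + 1 + 1)‖ + ‖f (n + 1 + 1) - f (n + 1)‖
        ≤ δ * ‖f (n + 1)‖ + (1 + δ)
          * (δ ^ 2 * ‖f (n + 1)‖ + (1 + δ ^ 2) * ‖f (n + 1) - f n‖) := by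
          nlinarith [mul_le_mul_of_nonneg_left e3 hδ.le]
      _ = (1 + (1 + δ) * δ) * (δ * ‖f (n + 1)‖)
          + (1 + δ) * (1 + δ ^ 2) * ‖f (n + 1) - f n‖ := by ring
      _ ≤ (1 + 3 * δ) * (δ * ‖f (n + 1)‖) + (1 + 3 * δ) * ‖f (n + 1) - f n‖ := by
          gcongr <;> nlinarith
      _ ≤ ρ * (δ * ‖f (n + 1)‖ + ‖f (n + 1) - f n‖) := by
          rw [← mul_add]
          gcongr)
  refine ⟨K / δ, ?_⟩
  filter_upwards [hK] with n hn
  have e1 : ‖f n‖ ≤ ‖f (n + 1)‖ + ‖f (n + 1) - f n‖ := by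
    have := norm_sub_le (f (n + 1)) (f (n + 1) - f n)
    rwa [sub_sub_cancel] at this
  rw [div_mul_eq_mul_div, le_div_iff₀ hδ]
  nlinarith [norm_nonneg (f (n + 1) - f n)]

theorem SubExp.summable {f : ℕ → ℂ} (hf : SubExp f) {c : ℂ} (hc : ‖c‖ < 1) :
    Summable fun n => ‖f n * c ^ n‖ := by
  obtain ⟨r, hr, hr1⟩ := exists_between hc
  have hr0 : 0 < r := (norm_nonneg c).trans_lt hr
  obtain ⟨K, hK⟩ := hf r⁻¹ (by rw [one_lt_inv₀ hr0]; exact hr1)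
  refine Summable.of_nonneg_of_le (fun n => norm_nonneg _) (fun n => ?_)
    ((summable_geometric_of_lt_one (r := ‖c‖ / r) (by positivity)
      ((div_lt_one hr0).2 hr)).mul_left K)
  rw [norm_mul, norm_pow, div_eq_inv_mul, mul_pow, ← mul_assoc]
  gcongr
  exact hK n

theorem tendsto_add_div_add (s t : ℂ) :
    Filter.Tendsto (fun n : ℕ => ((n : ℂ) + s) / (n + t)) Filter.atTop (𝓝 1) := by
  have h1 := tendsto_natCast_div_add_atTop t
  have h2 : Filter.Tendsto (fun n : ℕ => ((n : ℂ) / (n + t)) * (1 + s * (1 / (n : ℂ))))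
      Filter.atTop (𝓝 1) := by
    simpa using h1.mul (tendsto_const_nhds.add
      ((tendsto_one_div_atTop_nhds_zero_nat (𝕜 := ℂ)).const_mul s))
  refine h2.congr' ?_
  filter_upwards [Filter.eventually_gt_atTop 0] with n hn
  have : (n : ℂ) ≠ 0 := by exact_mod_cast hn.ne'
  rw [div_mul_eq_mul_div]
  congr 1
  field_simp

theorem tendsto_one_div_add (t : ℂ) :
    Filter.Tendsto (fun n : ℕ => 1 / ((n : ℂ) + t)) Filter.atTop (𝓝 0) := by
  have h2 : Filter.Tendsto (fun n : ℕ => ((n : ℂ) / (n + t)) * (1 / (n : ℂ)))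
      Filter.atTop (𝓝 0) := by
    simpa using (tendsto_natCast_div_add_atTop t).mul (tendsto_one_div_atTop_nhds_zero_nat (𝕜 := ℂ))
  refine h2.congr' ?_
  filter_upwards [Filter.eventually_gt_atTop 0] with n hn
  have : (n : ℂ) ≠ 0 := by exact_mod_cast hn.ne'
  rw [div_mul_div_comm, mul_one, mul_comm, div_mul_cancel_left₀ this, one_div]

theorem eventually_natCast_add_ne_zero (t : ℂ) : ∀ᶠ n : ℕ in Filter.atTop, (n : ℂ) + t ≠ 0 := by
  filter_upwards [Filter.eventually_gt_atTop ⌈‖t‖⌉₊] with n hn h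
  have h1 : (n : ℝ) = ‖t‖ := by
    have := congrArg norm (eq_neg_of_add_eq_zero_left h)
    simpa using this
  exact absurd (Nat.lt_of_ceil_lt hn) (by rw [h1]; exact lt_irrefl _)

/-! ### Growth of the generating coefficients -/

theorem inv_Gamma_eq (g : ℂ) : (Complex.Gamma g)⁻¹ = g * (Complex.Gamma (g + 1))⁻¹ :=
  by simpa using Complex.one_div_Gamma_eq_self_mul_one_div_Gamma_add_one g

theorem poch_mul_inv_Gamma (g : ℂ) (m : ℕ) :
    poch g m * (Complex.Gamma (g + m))⁻¹ = (Complex.Gamma g)⁻¹ := by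
  induction m with
  | zero => simp [poch_zero]
  | succ m ih =>
    rw [← ih, inv_Gamma_eq (g + m), poch_succ]
    push_cast
    ring_nf

/-- The weight `1 / (n! Γ(g + n))`, an entire function of `g`. -/
noncomputable def weight (g : ℂ) (n : ℕ) : ℂ := (n.factorial : ℂ)⁻¹ * (Complex.Gamma (g + n))⁻¹

theorem weight_succ (g : ℂ) (n : ℕ) : (n + 1) * (g + n) * weight g (n + 1) = weight g n := by
  have h : ((n : ℂ) + 1) ≠ 0 := n.cast_add_one_ne_zero
  have h' : (n.factorial : ℂ) ≠ 0 := by exact_mod_cast n.factorial_ne_zero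
  rw [weight, weight, inv_Gamma_eq (g + n), Nat.factorial_succ]
  push_cast
  rw [← add_assoc]
  field_simp

theorem subExp_wilsonProd_mul_weight (e y g : ℂ) :
    SubExp fun k => wilsonProd e y k * weight g k := by
  refine SubExp.of_ratio (α := fun k => ((k : ℂ) + e) / (k + 1) * ((k + e) / (k + g))
    + y * (1 / ((k : ℂ) + 1)) * (1 / (k + g))) ?_ ?_
  · simpa using ((tendsto_add_div_add e 1).mul (tendsto_add_div_add e g)).add
      (((tendsto_one_div_add 1).const_mul y).mul (tendsto_one_div_add g))
  · filter_upwards [eventually_natCast_add_ne_zero g] with k hk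
    have h : ((k : ℂ) + 1) ≠ 0 := k.cast_add_one_ne_zero
    rw [wilsonProd_succ, ← weight_succ g k]
    field_simp
    ring

/-- The coefficients `S_n(y; a, b, e) / (n! Γ(a + e + n))` of the generating function
`(1 - c) ^ (-b - e) ₂F₁(e + is, e - is; a + e; c / (c - 1)) / Γ(a + e)`. -/
noncomputable def genCoeff (y a b e : ℂ) (n : ℕ) : ℂ := contDualHahn n y a b e * weight (a + e) n

theorem subExp_genCoeff (y a b e : ℂ) : SubExp (genCoeff y a b e) := by
  refine SubExp.of_recurrence
    (α := fun n => ((n : ℂ) + (1 + a + b)) / (n + 2) * ((n + (1 + a + e)) / (n + (a + e + 1)))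
      + ((n : ℂ) + 1) / (n + 2) * ((n + (b + e)) / (n + (a + e + 1)))
      - (a ^ 2 + y) * (1 / ((n : ℂ) + 2)) * (1 / (n + (a + e + 1))))
    (γ := fun n => ((n : ℂ) + (b + e)) / (n + 2) * ((n + (a + b)) / (n + (a + e + 1)))) ?_ ?_ ?_
  · have := (((tendsto_add_div_add (1 + a + b) 2).mul
      (tendsto_add_div_add (1 + a + e) (a + e + 1))).add
      ((tendsto_add_div_add 1 2).mul (tendsto_add_div_add (b + e) (a + e + 1)))).sub
      (((tendsto_one_div_add 2).const_mul (a ^ 2 + y)).mul (tendsto_one_div_add (a + e + 1)))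
    convert this using 2
    norm_num
  · simpa using (tendsto_add_div_add (b + e) 2).mul (tendsto_add_div_add (a + b) (a + e + 1))
  · filter_upwards [eventually_natCast_add_ne_zero (a + e + 1)] with n hn
    have h2 : (n : ℂ) + 2 ≠ 0 := by exact_mod_cast (show n + 2 ≠ 0 by omega)
    have w0 := weight_succ (a + e) n
    have w1 := weight_succ (a + e) (n + 1)
    have r := contDualHahn_rec (n + 1) y a b e
    rw [Nat.add_sub_cancel] at r
    rw [genCoeff, genCoeff, genCoeff, r, ← w0, ← w1]
    push_cast
    field_simp
    ring

/-! ### The generating function and the hypergeometric function -/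

/-- The binomial series. -/
theorem hasSum_one_sub_cpow_neg (α : ℂ) {c : ℂ} (hc : ‖c‖ < 1) :
    HasSum (fun m : ℕ => poch α m / (m.factorial : ℂ) * c ^ m) ((1 - c) ^ (-α)) := by
  have h := (Complex.one_div_one_sub_cpow_hasFPowerSeriesOnBall_zero α).hasSum (y := c)
    (by simpa [Metric.mem_eball, edist_zero_right, ← ofReal_norm] using hc)
  rw [zero_add, one_div, ← Complex.cpow_neg] at h
  refine h.congr_fun fun m => ?_
  have hm := Ring.factorial_nsmul_multichoose_eq_ascPochhammer α m
  rw [Polynomial.ascPochhammer_smeval_eq_eval, nsmul_eq_mul] at hm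
  have h0 : (m.factorial : ℂ) ≠ 0 := by exact_mod_cast m.factorial_ne_zero
  rw [FormalMultilinearSeries.ofScalars_apply_eq, smul_eq_mul, Ring.choose, poch, ← hm,
    mul_div_cancel_left₀ _ h0]
  congr 2
  ring

theorem norm_poch_div_factorial_le (α : ℂ) (k m : ℕ) :
    ‖poch (α + k) m / (m.factorial : ℂ)‖ ≤ 2 ^ (⌈‖α‖⌉₊ + k + m) := by
  have h : ‖poch (α + k) m‖ ≤ ((⌈‖α‖⌉₊ + k).ascFactorial m : ℝ) := by
    induction m with
    | zero => simp [poch_zero]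
    | succ m ih =>
      rw [poch_succ, norm_mul, Nat.ascFactorial_succ, mul_comm, Nat.cast_mul]
      refine mul_le_mul ?_ ih (norm_nonneg _) (Nat.cast_nonneg _)
      calc ‖α + k + m‖ ≤ ‖α‖ + k + m := by
            refine (norm_add_le _ _).trans ?_
            rw [Complex.norm_natCast]
            gcongr
            refine (norm_add_le _ _).trans ?_
            rw [Complex.norm_natCast]
        _ ≤ _ := by
            push_cast
            gcongr
            exact Nat.le_ceil _
  rw [norm_div, Complex.norm_natCast, div_le_iff₀ (by exact_mod_cast m.factorial_pos)]
  refine h.trans ?_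
  have h2 : (⌈‖α‖⌉₊ + k).ascFactorial m ≤ 2 ^ (⌈‖α‖⌉₊ + k + m) * m.factorial := by
    rw [Nat.ascFactorial_eq_factorial_mul_choose', mul_comm]
    refine Nat.mul_le_mul_right _ ((Nat.choose_le_two_pow _ _).trans ?_)
    exact Nat.pow_le_pow_right two_pos (Nat.sub_le _ _)
  exact_mod_cast h2

/-- The sum with `e` as distinguished parameter. In it the factor `(a + e + k)_{n-k}` cancels
against `1 / Γ(a + e + n)`, and what remains is a Cauchy product with a binomial series. -/
theorem genCoeff_eq_sum (y a b e : ℂ) (n : ℕ) :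
    genCoeff y a b e n = ∑ kl ∈ Finset.HasAntidiagonal.antidiagonal n, (-1) ^ kl.1
      * (wilsonProd e y kl.1 * weight (a + e) kl.1)
      * (poch (b + e + kl.1) kl.2 / (kl.2.factorial : ℂ)) := by
  rw [genCoeff, contDualHahn_symm, contDualHahn_eq_sum,
    Finset.Nat.sum_antidiagonal_eq_sum_range_succ_mk, Finset.sum_mul]
  refine Finset.sum_congr rfl fun k hk => ?_
  obtain ⟨m, rfl⟩ := Nat.exists_eq_add_of_le (Nat.lt_succ_iff.mp (Finset.mem_range.mp hk))
  have hc : ((k + m).choose k : ℂ) * k.factorial * m.factorial = (k + m).factorial := by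
    have := Nat.choose_mul_factorial_mul_factorial (Nat.le_add_right k m)
    rw [Nat.add_sub_cancel_left] at this
    exact_mod_cast this
  have hG := poch_mul_inv_Gamma (a + e + k) m
  have h1 : (k.factorial : ℂ) ≠ 0 := by exact_mod_cast k.factorial_ne_zero
  have h2 : (m.factorial : ℂ) ≠ 0 := by exact_mod_cast m.factorial_ne_zero
  have h3 : ((k + m).choose k : ℂ) ≠ 0 := by
    exact_mod_cast (Nat.choose_pos (Nat.le_add_right k m)).ne'
  simp only [Nat.add_sub_cancel_left, weight]
  rw [← hG, ← hc, add_comm e b, add_comm e a, Nat.cast_add, add_assoc (a + e)]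
  field_simp

/-- The terms of the double series obtained by expanding `S_n` and collecting powers of `c`. -/
noncomputable def genTerm (y a b e c : ℂ) (kl : ℕ × ℕ) : ℂ :=
  (-c) ^ kl.1 * (wilsonProd e y kl.1 * weight (a + e) kl.1)
    * (poch (b + e + kl.1) kl.2 / (kl.2.factorial : ℂ) * c ^ kl.2)

theorem hasSum_genTerm_row (y a b e : ℂ) {c : ℂ} (hc : ‖c‖ < 1) (k : ℕ) :
    HasSum (fun m => genTerm y a b e c (k, m)) ((-c) ^ k * (wilsonProd e y k * weight (a + e) k)
      * (1 - c) ^ (-(b + e + k))) := by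
  have h := (hasSum_one_sub_cpow_neg (b + e + k) hc).mul_left
    ((-c) ^ k * (wilsonProd e y k * weight (a + e) k))
  exact h.congr_fun fun m => by rw [genTerm]

theorem summable_genTerm (y a b e : ℂ) {c : ℂ} (hc : ‖c‖ < 1 / 4) :
    Summable (genTerm y a b e c) := by
  obtain ⟨K, hK⟩ := subExp_wilsonProd_mul_weight e y (a + e) 2 one_lt_two
  have g1 := summable_geometric_of_lt_one (r := 4 * ‖c‖) (by positivity) (by linarith)
  have g2 := summable_geometric_of_lt_one (r := 2 * ‖c‖) (by positivity) (by linarith)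
  have g3 : Summable fun x : ℕ × ℕ => (4 * ‖c‖) ^ x.1 * (2 * ‖c‖) ^ x.2 :=
    g1.mul_of_nonneg g2 (fun n => pow_nonneg (by positivity) n)
      (fun n => pow_nonneg (by positivity) n)
  refine Summable.of_norm_bounded (g3.mul_left (K * 2 ^ ⌈‖b + e‖⌉₊)) ?_
  rintro ⟨k, m⟩
  rw [genTerm, norm_mul, norm_mul, norm_mul _ (c ^ m), norm_pow, norm_neg, norm_pow]
  have hK0 := (norm_nonneg _).trans (hK k)
  calc ‖c‖ ^ k * ‖wilsonProd e y k * weight (a + e) k‖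
        * (‖poch (b + e + k) m / (m.factorial : ℂ)‖ * ‖c‖ ^ m)
      ≤ ‖c‖ ^ k * (K * 2 ^ k) * (2 ^ (⌈‖b + e‖⌉₊ + k + m) * ‖c‖ ^ m) := by
        refine mul_le_mul (mul_le_mul_of_nonneg_left (hK k) (by positivity))
          (mul_le_mul_of_nonneg_right (norm_poch_div_factorial_le _ _ _) (by positivity))
          (by positivity) (by positivity)
    _ = K * 2 ^ ⌈‖b + e‖⌉₊ * ((4 * ‖c‖) ^ k * (2 * ‖c‖) ^ m) := by
        rw [show (4 : ℝ) = 2 * 2 by norm_num]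
        simp only [mul_pow, pow_add]
        ring

theorem sum_antidiagonal_genTerm (y a b e c : ℂ) (n : ℕ) :
    ∑ kl ∈ Finset.HasAntidiagonal.antidiagonal n, genTerm y a b e c kl
      = genCoeff y a b e n * c ^ n := by
  rw [genCoeff_eq_sum, Finset.sum_mul]
  refine Finset.sum_congr rfl fun kl hkl => ?_
  rw [← Finset.HasAntidiagonal.mem_antidiagonal.1 hkl, genTerm, neg_pow, pow_add]
  ring

theorem hasSum_sum_antidiagonal {f : ℕ × ℕ → ℂ} (hf : Summable f) :
    HasSum (fun n => ∑ kl ∈ Finset.HasAntidiagonal.antidiagonal n, f kl) (∑' kl, f kl) := by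
  have h := (Finset.HasAntidiagonal.sigmaAntidiagonalEquivProd (A := ℕ)).hasSum_iff.2 hf.hasSum
  exact (h.sigma fun n => hasSum_fintype _).congr_fun fun n => (Finset.sum_coe_sort _ f).symm

theorem wilsonProd_mul_weight_mul_cpow (a b e s : ℂ) {c : ℂ} (hc : 1 - c ≠ 0) (k : ℕ) :
    (-c) ^ k * (wilsonProd e (s ^ 2) k * weight (a + e) k) * (1 - c) ^ (-(b + e + k))
      = (1 - c) ^ (-(b + e)) * (poch (e + Complex.I * s) k * poch (e - Complex.I * s) k
        * (Complex.Gamma (a + e + k))⁻¹ / (k.factorial : ℂ) * (c / (c - 1)) ^ k) := by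
  have h0 : c / (c - 1) = -c / (1 - c) := by rw [← neg_sub 1 c, div_neg, neg_div]
  rw [wilsonProd_eq_poch, neg_add, Complex.cpow_add _ _ hc, Complex.cpow_neg _ (k : ℂ),
    Complex.cpow_natCast, weight, h0, div_pow]
  ring

/-- The generating function for small `c`, where the double series may be rearranged. -/
theorem tsum_genCoeff_eq_of_norm_lt (a b e s : ℂ) {c : ℂ} (hc : ‖c‖ < 1 / 4) :
    ∑' n, genCoeff (s ^ 2) a b e n * c ^ n = (1 - c) ^ (-(b + e))
      * hypSeriesReg (e + Complex.I * s) (e - Complex.I * s) (a + e) (c / (c - 1)) := by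
  have hc1 : ‖c‖ < 1 := hc.trans (by norm_num)
  have hc0 : 1 - c ≠ 0 := fun h => by
    rw [← sub_eq_zero.1 h] at hc1
    simp at hc1
  have hsum := summable_genTerm (s ^ 2) a b e hc
  have hrow : HasSum (fun k : ℕ => (-c) ^ k * (wilsonProd e (s ^ 2) k * weight (a + e) k)
      * (1 - c) ^ (-(b + e + k))) (∑' kl, genTerm (s ^ 2) a b e c kl) :=
    HasSum.prod_fiberwise hsum.hasSum (hasSum_genTerm_row (s ^ 2) a b e hc1)
  have hdiag := hasSum_sum_antidiagonal hsum
  simp only [sum_antidiagonal_genTerm] at hdiag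
  rw [hdiag.tsum_eq, ← hrow.tsum_eq, hypSeriesReg, ← tsum_mul_left]
  exact tsum_congr fun k => wilsonProd_mul_weight_mul_cpow a b e s hc0 k

theorem differentiableOn_tsum_mul_pow {f : ℕ → ℂ} (hf : SubExp f) :
    DifferentiableOn ℂ (fun c => ∑' n, f n * c ^ n) (Metric.ball 0 1) := by
  intro c hc
  rw [mem_ball_zero_iff] at hc
  obtain ⟨r, hr, hr1⟩ := exists_between hc
  have hr0 : 0 < r := (norm_nonneg c).trans_lt hr
  have hs : Summable fun n => ‖f n * (r : ℂ) ^ n‖ :=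
    hf.summable (by rwa [Complex.norm_real, Real.norm_of_nonneg hr0.le])
  have h := Complex.differentiableOn_tsum_of_summable_norm (F := fun n (c : ℂ) => f n * c ^ n) hs
    (fun n => ((differentiable_id.pow n).const_mul (f n)).differentiableOn) (Metric.isOpen_ball (x := (0 : ℂ)) (ε := r)) (fun n w hw => by
      rw [mem_ball_zero_iff] at hw
      rw [norm_mul, norm_mul, norm_pow, norm_pow, Complex.norm_real, Real.norm_of_nonneg hr0.le]
      gcongr)
  exact (h.differentiableAt (Metric.isOpen_ball.mem_nhds (by rwa [mem_ball_zero_iff]))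
    ).differentiableWithinAt

theorem norm_lt_norm_sub_one {z : ℂ} (hz : z.re < 1 / 2) : ‖z‖ < ‖z - 1‖ := by
  rw [← sq_lt_sq₀ (norm_nonneg _) (norm_nonneg _), ← Complex.normSq_eq_norm_sq,
    ← Complex.normSq_eq_norm_sq, Complex.normSq_apply, Complex.normSq_apply]
  simp
  nlinarith

/-- The generating function gives the analytic continuation of `₂F₁`: the right-hand side is
holomorphic for `‖c‖ < 1`, that is, for `z = c / (c - 1)` in the half-plane `re z < 1 / 2`. -/
theorem hypReg_eq_tsum_genCoeff (a b e s : ℂ) {c : ℝ} (hc₀ : 0 < c) (hc₁ : c < 1) :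
    hypReg (e + Complex.I * s) (e - Complex.I * s) (a + e) (c / (c - 1))
      = (1 - c : ℂ) ^ (b + e) * ∑' n, genCoeff (s ^ 2) a b e n * (c : ℂ) ^ n := by
  have hne : ∀ z : ℂ, z.re < 1 / 2 → z - 1 ≠ 0 := fun z hz h => by
    rw [sub_eq_zero.1 h] at hz
    norm_num at hz
  have hball : ∀ z : ℂ, z.re < 1 / 2 → z / (z - 1) ∈ Metric.ball (0 : ℂ) 1 := fun z hz => by
    rw [mem_ball_zero_iff, norm_div, div_lt_one (norm_pos_iff.2 (hne z hz))]
    exact norm_lt_norm_sub_one hz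
  have hinv : ∀ z : ℂ, z - 1 ≠ 0 → z / (z - 1) / (z / (z - 1) - 1) = z := fun z hz => by
    have : z / (z - 1) - 1 = 1 / (z - 1) := by field_simp; ring
    rw [this]
    field_simp
  have hc : (c : ℂ) - 1 ≠ 0 := by
    rw [sub_ne_zero]
    exact_mod_cast hc₁.ne
  -- `z ↦ z / (z - 1)` is an involution, so `c` is recovered from `z = c / (c - 1)` by the same map
  refine IsStarContinuation.eq ⟨{z | z.re < 1 / 2}, fun z => (1 - z / (z - 1)) ^ (b + e)
    * ∑' n, genCoeff (s ^ 2) a b e n * (z / (z - 1)) ^ n, ?_, ?_, ?_, ?_, ?_, ?_⟩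
  · exact isOpen_lt Complex.continuous_re continuous_const
  · exact (convex_halfSpace_re_lt _).starConvex (by simp)
  · have : ((c : ℂ) / (c - 1)).re = c / (c - 1) := by
      rw [← Complex.ofReal_one, ← Complex.ofReal_sub, ← Complex.ofReal_div, Complex.ofReal_re]
    rw [Set.mem_ofPred_eq, this]
    have : c / (c - 1) < 0 := div_neg_of_pos_of_neg hc₀ (by linarith)
    linarith
  · have hd : DifferentiableOn ℂ (fun z : ℂ => z / (z - 1)) {z | z.re < 1 / 2} :=
      differentiableOn_id.div (differentiableOn_id.sub_const 1) hne
    refine DifferentiableOn.mul (DifferentiableOn.cpow_const (hd.const_sub 1) fun z hz => ?_)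
      ((differentiableOn_tsum_mul_pow (subExp_genCoeff (s ^ 2) a b e)).comp hd hball)
    have h := hball z hz
    rw [mem_ball_zero_iff] at h
    have h2 := (Complex.re_le_norm _).trans_lt h
    left
    rw [Complex.sub_re, Complex.one_re]
    linarith
  · have hcont : ContinuousAt (fun z : ℂ => z / (z - 1)) 0 :=
      continuousAt_id.div (continuousAt_id.sub continuousAt_const) (by simp)
    have h1 : ∀ᶠ z in 𝓝 (0 : ℂ), ‖z / (z - 1)‖ < 1 / 4 :=
      hcont.norm.eventually_lt_const (by norm_num)
    have h2 : ∀ᶠ z in 𝓝 (0 : ℂ), z - 1 ≠ 0 :=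
      (continuousAt_id.sub continuousAt_const).eventually_ne (by simp)
    filter_upwards [h1, h2] with z hz hz1
    have h3 : 1 - z / (z - 1) ≠ 0 := by
      have : 1 - z / (z - 1) = -(1 / (z - 1)) := by field_simp; ring
      rw [this]
      exact neg_ne_zero.2 (one_div_ne_zero hz1)
    rw [tsum_genCoeff_eq_of_norm_lt a b e s hz, ← mul_assoc, ← Complex.cpow_add _ _ h3,
      add_neg_cancel, Complex.cpow_zero, one_mul, hinv z hz1]
  · simp only
    rw [hinv _ hc]

/-! ### The boundary cases `x₂ = 0` and `x₁ = 0` -/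

theorem ne_zero_of_re_pos {β : ℂ} (hβ : 0 < β.re) : β ≠ 0 := fun h => by simp [h] at hβ

theorem add_one_re_pos {β : ℂ} (hβ : 0 < β.re) : 0 < (β + 1).re := by
  rw [Complex.add_re, Complex.one_re]
  linarith

theorem subExp_meixner (x : ℕ) (c : ℂ) : ∀ {β : ℂ}, 0 < β.re →
    SubExp fun n => meixner n x β c := by
  induction x with
  | zero =>
    intro β _
    simpa only [meixner_zero_right] using SubExp.const 1
  | succ x ih =>
    intro β hβ
    have hV := ih (add_one_re_pos hβ)
    have h := (SubExp.const β⁻¹).mul ((((SubExp.const β).add SubExp.natCast).mul hV).sub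
      ((SubExp.natCast.mul (SubExp.const c⁻¹)).mul
        (hV.comp (j := fun n => n - 1) (d := 0) fun n => Nat.sub_le n 1)))
    refine (funext fun n => ?_ : (fun n => _) = fun n => meixner n (x + 1 : ℕ) β c) ▸ h
    have := meixner_add_one n x hβ c
    rw [← div_eq_mul_inv, ← this, inv_mul_cancel_left₀ (ne_zero_of_re_pos hβ)]

theorem subExp_meixner_toNat (x : ℕ) (c : ℂ) {β : ℂ} (hβ : 0 < β.re) (p : ℤ) :
    SubExp fun n => meixner ((n : ℤ) + p).toNat x β c :=
  (subExp_meixner x c hβ).comp (j := fun n => ((n : ℤ) + p).toNat) (d := p.toNat)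
    fun n => by omega

theorem weight_lower (g : ℂ) (n : ℕ) : (g + n) * weight (g + 1) n = weight g n := by
  rw [weight, weight, inv_Gamma_eq (g + n), add_right_comm]
  ring

theorem weight_raise (g : ℂ) (n : ℕ) : (n + 1) * weight g (n + 1) = weight (g + 1) n := by
  have h : ((n : ℂ) + 1) ≠ 0 := n.cast_add_one_ne_zero
  have h' : (n.factorial : ℂ) ≠ 0 := by exact_mod_cast n.factorial_ne_zero
  rw [weight, weight, Nat.factorial_succ, add_right_comm g]
  push_cast
  rw [← add_assoc]
  field_simp

/-- The weight vanishes where `1 / Γ` does. -/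
theorem weight_eq_zero {p : ℤ} {n : ℕ} (h : (n : ℤ) + p < 0) : weight (p + 1) n = 0 := by
  obtain ⟨m, hm⟩ := Int.eq_ofNat_of_zero_le (show 0 ≤ -((n : ℤ) + p + 1) by omega)
  have h1 : (p : ℂ) + 1 + n = -(m : ℂ) := by
    have : (p : ℤ) + 1 + n = -(m : ℤ) := by omega
    exact_mod_cast this
  rw [weight, h1, Complex.Gamma_neg_nat_eq_zero, inv_zero, mul_zero]

theorem hasSum_shift {q : ℕ → ℂ} {T : ℂ} (hq : HasSum q T) :
    HasSum (fun n => if n = 0 then 0 else q (n - 1)) T := by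
  rw [← hasSum_nat_add_iff' 1]
  simpa using hq

theorem hasSum_sub_shift {q : ℕ → ℂ} (hq : Summable q) :
    HasSum (fun n => q n - if n = 0 then 0 else q (n - 1)) 0 := by
  simpa using hq.hasSum.sub (hasSum_shift hq.hasSum)

/-- Lowering the distinguished parameter, from `contDualHahn_raise_last` and the symmetry. -/
theorem contDualHahn_lower (n : ℕ) (y a b e : ℂ) :
    contDualHahn (n + 1) y a b e - contDualHahn (n + 1) y (a - 1) b e
      = (n + 1) * (b + e + n) * contDualHahn n y a b e := by
  have h := contDualHahn_raise_last n y e b (a - 1)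
  rwa [sub_add_cancel, contDualHahn_symm _ y e b a, contDualHahn_symm _ y e b (a - 1),
    contDualHahn_symm _ y e b a] at h

/-- The case `x₂ = 0`, by induction on `x = x₁`. The step from `x` to `x + 1` replaces `(a, β, p)`
by `(a - 1, β + 1, p - 1)`, up to a telescoping series; `e` and `β + p` do not change. -/
theorem hasSum_genCoeff_mul_meixner_left (y b e : ℂ) {c : ℂ} (hc₀ : c ≠ 0) (hc₁ : ‖c‖ < 1)
    (x : ℕ) : ∀ (a : ℂ) {β : ℂ} (p : ℤ), 0 < β.re → a + e = p + 1 → b + e = β + p →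
    HasSum (fun n : ℕ => poch β x * genCoeff y a b e n
      * meixner ((n : ℤ) + p).toNat x β c * c ^ n)
      ((-1 / c) ^ x * ∑' n, genCoeff y (a - x) b e n * c ^ n) := by
  induction x with
  | zero =>
    intro a β p _ _ _
    simp only [meixner_zero_right]
    simpa [poch_zero] using
      ((subExp_genCoeff y a b e).summable hc₁).of_norm.hasSum
  | succ x ih =>
    intro a β p hβ hae hbe
    have hβ1 := add_one_re_pos hβ
    have hV := subExp_meixner_toNat x c hβ1 p
    set q : ℕ → ℂ := fun n => poch (β + 1) x * genCoeff y a b e n * (β + p + n)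
      * meixner ((n : ℤ) + p).toNat x (β + 1) c * c ^ n with hq
    have hqs : Summable q :=
      (SubExp.summable (((SubExp.const _).mul (subExp_genCoeff y a b e)).mul
        ((SubExp.const (β + p)).add SubExp.natCast) |>.mul hV) hc₁).of_norm
    have hrec := ih (a - 1) (p - 1) hβ1 (by push_cast; linear_combination hae)
      (by push_cast; linear_combination hbe)
    have hsum := (hasSum_sub_shift hqs).add (hrec.mul_left (-1 / c))
    convert hsum using 1
    · funext n
      -- for `n + p < 0` the truncated degree is meaningless, but all weights vanish
      rcases lt_or_ge ((n : ℤ) + p) 0 with hn | hn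
      · have w0 : weight (p + 1) n = 0 := weight_eq_zero hn
        have w1 : weight p n = 0 := by rw [← weight_lower, w0, mul_zero]
        have g0 : genCoeff y a b e n = 0 := by rw [genCoeff, hae, w0, mul_zero]
        have g1 : genCoeff y (a - 1) b e n = 0 := by
          rw [genCoeff, show a - 1 + e = p by linear_combination hae, w1, mul_zero]
        have g2 : (if n = 0 then 0 else q (n - 1)) = 0 := by
          rcases n with _ | n
          · rfl
          · have : weight (p + 1) n = 0 := weight_eq_zero (by push_cast at hn; omega)
            simp [hq, genCoeff, hae, this]
        have g3 : q n = 0 := by simp [hq, g0]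
        rw [g0, g1, g2, g3]
        ring
      · obtain ⟨N, hN⟩ := Int.eq_ofNat_of_zero_le hn
        have hNc : (N : ℂ) = n + p := by
          have : (N : ℤ) = n + p := hN.symm
          exact_mod_cast this
        have hN1 : ((n : ℤ) + (p - 1)).toNat = N - 1 := by omega
        have hN0 : ((n : ℤ) + p).toNat = N := by omega
        have hm := meixner_add_one N x hβ c
        have hw := weight_lower p n
        have hT : poch β (x + 1) * genCoeff y a b e n * meixner N (x + 1 : ℕ) β c * c ^ n
            = q n - poch (β + 1) x * contDualHahn n y a b e * weight p n / c
              * meixner (N - 1) x (β + 1) c * c ^ n := by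
          simp only [hq]
          rw [poch_succ_left, hN0, ← hw, genCoeff, hae]
          rw [hNc] at hm
          linear_combination (poch (β + 1) x * contDualHahn n y a b e * weight (p + 1) n * c ^ n)
            * hm
        have g1 : genCoeff y (a - 1) b e n = contDualHahn n y (a - 1) b e * weight p n := by
          rw [genCoeff, show a - 1 + e = p by linear_combination hae]
        rw [hN0, hT, hN1, g1]
        rcases n with _ | n
        · simp only [contDualHahn_zero, if_true]
          ring
        · have hs := contDualHahn_lower n y a b e
          have hN2 : ((n : ℤ) + p).toNat = N - 1 := by push_cast at hN; omega
          have hw1 := weight_succ (p + 1) n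
          have hw2 := weight_lower p (n + 1)
          have hw3 : weight (p + 1) n = (n + 1) * weight p (n + 1) := by
            rw [← hw1, ← hw2]
            push_cast
            ring
          rw [if_neg (Nat.succ_ne_zero n), Nat.add_sub_cancel]
          simp only [hq]
          rw [hN2, genCoeff, genCoeff, hae, hw3, pow_succ]
          rw [hbe] at hs
          field_simp
          linear_combination (-(poch (β + 1) x * weight p (n + 1) * meixner (N - 1) x (β + 1) c)) * hs
    · rw [pow_succ, show a - ((x + 1 : ℕ) : ℂ) = a - 1 - x by push_cast; ring]
      ring

/-- The case `x₁ = 0`, by induction on `x = x₂`. The step from `x` to `x + 1` replaces `(a, β)`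
by `(a + 1, β + 1)`, up to a telescoping series; `b` and `e` do not change. -/
theorem hasSum_genCoeff_mul_meixner_right (y b e : ℂ) {c : ℂ} (hc₀ : c ≠ 0) (hc₁ : ‖c‖ < 1)
    (x : ℕ) : ∀ (a : ℂ) {β : ℂ}, 0 < β.re → a + b = β →
    HasSum (fun n : ℕ => poch β x * genCoeff y a b e n * meixner n x β c * c ^ n)
      (wilsonProd a y x * ∑' n, genCoeff y (a + x) b e n * c ^ n) := by
  induction x with
  | zero =>
    intro a β _ _
    simp only [meixner_zero_right]
    simpa [poch_zero, wilsonProd_zero] using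
      ((subExp_genCoeff y a b e).summable hc₁).of_norm.hasSum
  | succ x ih =>
    intro a β hβ hab
    have hβ1 := add_one_re_pos hβ
    have hV := subExp_meixner x c hβ1
    set q : ℕ → ℂ := fun n => poch (β + 1) x * genCoeff y a b e n * (β + n)
      * meixner n x (β + 1) c * c ^ n with hq
    have hqs : Summable q :=
      (SubExp.summable (((SubExp.const _).mul (subExp_genCoeff y a b e)).mul
        ((SubExp.const β).add SubExp.natCast) |>.mul hV) hc₁).of_norm
    have hrec := ih (a + 1) hβ1 (by linear_combination hab)
    have hsum := (hasSum_sub_shift hqs).add (hasSum_shift (hrec.mul_left (a ^ 2 + y)))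
    convert hsum using 1
    · funext n
      have hm := meixner_add_one n x hβ c
      have hT : poch β (x + 1) * genCoeff y a b e n * meixner n (x + 1 : ℕ) β c * c ^ n
          = q n - poch (β + 1) x * genCoeff y a b e n * n / c
              * meixner (n - 1) x (β + 1) c * c ^ n := by
        simp only [hq]
        rw [poch_succ_left]
        linear_combination (poch (β + 1) x * genCoeff y a b e n * c ^ n) * hm
      rw [hT]
      rcases n with _ | n
      · simp
      · have hs := contDualHahn_raise n y a b e
        have hw1 := weight_raise (a + e) n
        have hw2 := weight_lower (a + e) n
        rw [if_neg (Nat.succ_ne_zero n), if_neg (Nat.succ_ne_zero n), Nat.add_sub_cancel]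
        simp only [hq]
        rw [genCoeff, genCoeff, genCoeff, ← hw2, add_right_comm a 1 e, ← hw1, pow_succ, ← hab]
        push_cast
        field_simp
        linear_combination ((n + 1) * poch (a + b + 1) x * weight (a + e) (n + 1)
          * meixner n x (a + b + 1) c) * hs
    · rw [wilsonProd_succ_left, show a + ((x + 1 : ℕ) : ℂ) = a + 1 + x by push_cast; ring]
      ring

/-! ### The recurrence along the diagonals -/

/-- The `n`-th term of the bilinear series, without the factor `(1 - c) ^ (b + e)`. -/
noncomputable def bilinTerm (y a b e β₁ β₂ c : ℂ) (p : ℤ) (x₁ x₂ n : ℕ) : ℂ :=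
  (-1) ^ (x₁ + x₂) * c ^ x₁ * poch β₁ x₁ * poch β₂ x₂ * genCoeff y a b e n
    * meixner ((n : ℤ) + p).toNat x₁ β₁ c * meixner n x₂ β₂ c * c ^ n

/-- The boundary terms in the summation by parts that moves the three-term recurrence of the
continuous dual Hahn polynomials to the Meixner polynomials. -/
noncomputable def partsTerm (y a b e β₁ β₂ c : ℂ) (p : ℤ) (x₁ x₂ n : ℕ) : ℂ :=
  ((n + 1) * (a + e + n) * genCoeff y a b e (n + 1)
      * (meixner ((n : ℤ) + p).toNat x₁ β₁ c * meixner n x₂ β₂ c)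
    - c * ((p + β₁ + n) * (β₂ + n)) * genCoeff y a b e n
      * (meixner (((n + 1 : ℕ) : ℤ) + p).toNat x₁ β₁ c * meixner (n + 1) x₂ β₂ c)) * c ^ n

variable {y a b e β₁ β₂ c : ℂ} {p : ℤ}

theorem summable_partsTerm (h₁ : 0 < β₁.re) (h₂ : 0 < β₂.re) (hc : ‖c‖ < 1) (x₁ x₂ : ℕ) :
    Summable (partsTerm y a b e β₁ β₂ c p x₁ x₂) := by
  have hS := subExp_genCoeff y a b e
  have hM := subExp_meixner_toNat x₁ c h₁ p
  have hN := subExp_meixner x₂ c h₂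
  have hn := SubExp.natCast
  have s1 : ∀ n : ℕ, n + 1 ≤ n + 1 := fun n => le_rfl
  exact (SubExp.summable ((((hn.add (SubExp.const 1)).mul ((SubExp.const (a + e)).add hn)).mul
    (hS.comp s1) |>.mul (hM.mul hN)).sub (((SubExp.const c).mul
    (((SubExp.const (p + β₁)).add hn).mul ((SubExp.const β₂).add hn))).mul hS |>.mul
    ((hM.comp s1).mul (hN.comp s1)))) hc).of_norm

/-- With `weight (p + 1) n` factored out, the boundary term visibly vanishes for `n + p < 0`. -/
theorem partsTerm_eq (hae : a + e = p + 1) (x₁ x₂ n : ℕ) :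
    partsTerm y a b e β₁ β₂ c p x₁ x₂ n = weight (p + 1) n * (contDualHahn (n + 1) y a b e
      * (meixner ((n : ℤ) + p).toNat x₁ β₁ c * meixner n x₂ β₂ c)
    - c * ((p + β₁ + n) * (β₂ + n)) * contDualHahn n y a b e
      * (meixner (((n + 1 : ℕ) : ℤ) + p).toNat x₁ β₁ c * meixner (n + 1) x₂ β₂ c)) * c ^ n := by
  have hw := weight_succ (a + e) n
  rw [partsTerm, genCoeff, genCoeff, ← hae, ← hw]
  ring

/-- The recurrence of the summands along the diagonals `x₁ - x₂ = const`. -/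
theorem bilinTerm_succ (h₁ : 0 < β₁.re) (h₂ : 0 < β₂.re) (hc : c ≠ 0) (hab : a + b = β₂)
    (hae : a + e = p + 1) (hbe : b + e = β₁ + p) (x₁ x₂ n : ℕ) :
    bilinTerm y a b e β₁ β₂ c p (x₁ + 1) (x₂ + 1) n
      = ((x₂ + β₂) * (x₁ + 1) + x₂ * (x₁ + β₁ - 1) - a ^ 2 - y)
          * bilinTerm y a b e β₁ β₂ c p x₁ x₂ n
        - x₁ * x₂ * (x₁ + β₁ - 1) * (x₂ + β₂ - 1)
          * bilinTerm y a b e β₁ β₂ c p (x₁ - 1) (x₂ - 1) n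
        - (-1) ^ (x₁ + x₂) * c ^ x₁ * poch β₁ x₁ * poch β₂ x₂
          * (partsTerm y a b e β₁ β₂ c p x₁ x₂ n
            - if n = 0 then 0 else partsTerm y a b e β₁ β₂ c p x₁ x₂ (n - 1)) := by
  -- for `n + p < 0` the truncated degree is meaningless, but all weights vanish
  rcases lt_or_ge ((n : ℤ) + p) 0 with hn | hn
  · have w0 : weight (p + 1) n = 0 := weight_eq_zero hn
    have g0 : genCoeff y a b e n = 0 := by rw [genCoeff, hae, w0, mul_zero]
    have g2 : (if n = 0 then 0 else partsTerm y a b e β₁ β₂ c p x₁ x₂ (n - 1)) = 0 := by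
      rcases n with _ | n
      · rfl
      · have : weight (p + 1) n = 0 := weight_eq_zero (by push_cast at hn; omega)
        rw [if_neg (Nat.succ_ne_zero n), Nat.add_sub_cancel, partsTerm_eq hae, this]
        ring
    rw [bilinTerm, bilinTerm, bilinTerm, g2, g0, partsTerm_eq hae, w0]
    ring
  · obtain ⟨N, hN⟩ := Int.eq_ofNat_of_zero_le hn
    have hNc : (N : ℂ) = n + p := by
      have : (N : ℤ) = n + p := hN.symm
      exact_mod_cast this
    have hN0 : ((n : ℤ) + p).toNat = N := by omega
    have hN1 : (((n + 1 : ℕ) : ℤ) + p).toNat = N + 1 := by omega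
    have hm := meixner_mul_meixner N n x₁ x₂ h₁ h₂ hc
    have hup : bilinTerm y a b e β₁ β₂ c p (x₁ + 1) (x₂ + 1) n
        = (-1) ^ (x₁ + x₂) * c ^ x₁ * poch β₁ x₁ * poch β₂ x₂ * genCoeff y a b e n * c ^ n
          * (c * (x₁ + β₁) * (x₂ + β₂)
            * (meixner N (x₁ + 1 : ℕ) β₁ c * meixner n (x₂ + 1 : ℕ) β₂ c)) := by
      rw [bilinTerm, hN0, poch_succ, poch_succ]
      ring
    have hdown : x₁ * x₂ * (x₁ + β₁ - 1) * (x₂ + β₂ - 1)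
          * bilinTerm y a b e β₁ β₂ c p (x₁ - 1) (x₂ - 1) n
        = (-1) ^ (x₁ + x₂) * c ^ x₁ * poch β₁ x₁ * poch β₂ x₂ * genCoeff y a b e n * c ^ n
          * (x₁ * x₂ / c
            * (meixner N (x₁ - 1 : ℕ) β₁ c * meixner n (x₂ - 1 : ℕ) β₂ c)) := by
      rcases x₁ with _ | x₁
      · simp
      · rcases x₂ with _ | x₂
        · simp
        · rw [bilinTerm, hN0, poch_succ, poch_succ, Nat.add_sub_cancel, Nat.add_sub_cancel]
          push_cast
          field_simp
          ring
    have hparts : partsTerm y a b e β₁ β₂ c p x₁ x₂ n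
            - (if n = 0 then 0 else partsTerm y a b e β₁ β₂ c p x₁ x₂ (n - 1))
        = genCoeff y a b e n * c ^ n * (((n + β₂) * (N + 1) + n * (N + β₁ - 1) - a ^ 2 - y)
            * (meixner N x₁ β₁ c * meixner n x₂ β₂ c)
          - n * N / c * (meixner (N - 1) x₁ β₁ c * meixner (n - 1) x₂ β₂ c)
          - c * (N + β₁) * (n + β₂) * (meixner (N + 1) x₁ β₁ c * meixner (n + 1) x₂ β₂ c)) := by
      have hr := contDualHahn_rec n y a b e
      have hβ₁ : β₁ = b + e - p := by linear_combination -hbe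
      rw [partsTerm_eq hae, hN0, hN1, hNc, genCoeff, hae, hr]
      rcases n with _ | n
      · rw [if_pos rfl, ← hab, hβ₁]
        push_cast
        linear_combination (weight (p + 1) 0 * contDualHahn 0 y a b e *
          (meixner N x₁ (b + e - p) c * meixner 0 x₂ (a + b) c) * (a + b)) * hae
      · have hN2 : ((n : ℤ) + p).toNat = N - 1 := by push_cast at hN; omega
        have hw := weight_succ (p + 1) n
        rw [if_neg (Nat.succ_ne_zero n), Nat.add_sub_cancel, partsTerm_eq hae, hN2, hN0, ← hw,
          pow_succ, ← hab, hβ₁, show (p : ℂ) = a + e - 1 by linear_combination -hae]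
        push_cast
        field_simp
        ring
    rw [hup, hdown, hparts, bilinTerm, hN0]
    linear_combination ((-1) ^ (x₁ + x₂) * c ^ x₁ * poch β₁ x₁ * poch β₂ x₂
      * genCoeff y a b e n * c ^ n) * hm

/-- If `a + e = 1 - n`, only the last term of the defining sum survives. -/
theorem contDualHahn_of_add_eq (n : ℕ) (y a b e : ℂ) (h : a + e = 1 - n) :
    contDualHahn n y a b e = (-1) ^ n * wilsonProd a y n := by
  rw [contDualHahn_eq_sum, Finset.sum_range_succ, Finset.sum_eq_zero]
  · simp [poch_zero]
  · intro k hk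
    obtain ⟨m, rfl⟩ := Nat.exists_eq_add_of_lt (Finset.mem_range.mp hk)
    have h2 : poch (a + e + k) (k + m + 1 - k) = 0 := by
      rw [show k + m + 1 - k = m + 1 by omega, poch_succ, h]
      push_cast
      ring
    rw [h2, mul_zero]

/-- The bilinear summation formula, with the hypergeometric function written as the generating
function of the continuous dual Hahn polynomials. On each diagonal `x₁ - x₂ = const` both sides
satisfy the same second-order recurrence, whose lowest term has the factor `x₁ x₂`; so a single
value, on the boundary, determines them. -/
theorem hasSum_bilinTerm (h₁ : 0 < β₁.re) (h₂ : 0 < β₂.re) (hc₀ : c ≠ 0) (hc₁ : ‖c‖ < 1)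
    (hab : a + b = β₂) (hae : a + e = p + 1) (hbe : b + e = β₁ + p) (x₂ : ℕ) : ∀ x₁ : ℕ,
    HasSum (bilinTerm y a b e β₁ β₂ c p x₁ x₂)
      (contDualHahn x₂ y a b (e - p + x₁ - x₂)
        * ∑' n, genCoeff y (a + x₂ - x₁) b e n * c ^ n) := by
  induction x₂ using Nat.strong_induction_on with
  | _ x₂ ih =>
    intro x₁
    rcases x₂ with _ | x₂
    · have h := (hasSum_genCoeff_mul_meixner_left y b e hc₀ hc₁ x₁ a p h₁ hae hbe).mul_left
        ((-c) ^ x₁)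
      have hv : contDualHahn 0 y a b (e - p + x₁ - (0 : ℕ))
          * ∑' n, genCoeff y (a + (0 : ℕ) - x₁) b e n * c ^ n
          = (-c) ^ x₁ * ((-1 / c) ^ x₁ * ∑' n, genCoeff y (a - x₁) b e n * c ^ n) := by
        have : -c * (-1 / c) = 1 := by field_simp
        rw [← mul_assoc, ← mul_pow, contDualHahn_zero, this, one_pow, Nat.cast_zero, add_zero]
      rw [hv]
      refine h.congr_fun fun n => ?_
      rw [bilinTerm, meixner_zero_right, poch_zero, neg_pow c, add_zero]
      ring
    rcases x₁ with _ | x₁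
    · have h := (hasSum_genCoeff_mul_meixner_right y b e hc₀ hc₁ (x₂ + 1) a h₂ hab).mul_left
        ((-1) ^ (x₂ + 1))
      have hv : contDualHahn (x₂ + 1) y a b (e - p + (0 : ℕ) - (x₂ + 1 : ℕ))
          * ∑' n, genCoeff y (a + (x₂ + 1 : ℕ) - (0 : ℕ)) b e n * c ^ n
          = (-1) ^ (x₂ + 1) * (wilsonProd a y (x₂ + 1)
            * ∑' n, genCoeff y (a + (x₂ + 1 : ℕ)) b e n * c ^ n) := by
        rw [contDualHahn_of_add_eq, ← mul_assoc, Nat.cast_zero, sub_zero]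
        rw [Nat.cast_zero]
        linear_combination hae
      rw [hv]
      refine h.congr_fun fun n => ?_
      rw [bilinTerm, meixner_zero_right, poch_zero, zero_add]
      ring
    · have hP := (hasSum_sub_shift (summable_partsTerm (y := y) (a := a) (b := b) (e := e)
        (p := p) h₁ h₂ hc₁ x₁ x₂)).mul_left ((-1) ^ (x₁ + x₂) * c ^ x₁ * poch β₁ x₁ * poch β₂ x₂)
      have hM := (ih x₂ (Nat.lt_succ_self x₂) x₁).mul_left
        ((x₂ + β₂) * (x₁ + 1) + x₂ * (x₁ + β₁ - 1) - a ^ 2 - y)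
      have hL := (ih (x₂ - 1) (by omega) (x₁ - 1)).mul_left
        (x₁ * x₂ * (x₁ + β₁ - 1) * (x₂ + β₂ - 1))
      have hr := contDualHahn_rec x₂ y a b (e - p + x₁ - x₂)
      have c1 : e - p + ((x₁ + 1 : ℕ) : ℂ) - ((x₂ + 1 : ℕ) : ℂ) = e - p + x₁ - x₂ := by
        push_cast; ring
      have c2 : a + ((x₂ + 1 : ℕ) : ℂ) - ((x₁ + 1 : ℕ) : ℂ) = a + x₂ - x₁ := by
        push_cast; ring
      have hlow : x₁ * x₂ * (x₁ + β₁ - 1) * (x₂ + β₂ - 1)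
            * (contDualHahn (x₂ - 1) y a b (e - p + (x₁ - 1 : ℕ) - (x₂ - 1 : ℕ))
              * ∑' n, genCoeff y (a + (x₂ - 1 : ℕ) - (x₁ - 1 : ℕ)) b e n * c ^ n)
          = x₁ * x₂ * (x₁ + β₁ - 1) * (x₂ + β₂ - 1)
            * (contDualHahn (x₂ - 1) y a b (e - p + x₁ - x₂)
              * ∑' n, genCoeff y (a + x₂ - x₁) b e n * c ^ n) := by
        rcases x₁ with _ | x₁
        · simp
        · rcases x₂ with _ | x₂
          · simp
          · rw [Nat.add_sub_cancel, Nat.add_sub_cancel]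
            rw [show e - p + ((x₁ + 1 : ℕ) : ℂ) - ((x₂ + 1 : ℕ) : ℂ) = e - p + x₁ - x₂ by
                push_cast; ring,
              show a + ((x₂ + 1 : ℕ) : ℂ) - ((x₁ + 1 : ℕ) : ℂ) = a + x₂ - x₁ by push_cast; ring]
      rw [hlow] at hL
      have hv : contDualHahn (x₂ + 1) y a b (e - p + x₁ - x₂)
          = ((x₂ + β₂) * (x₁ + 1) + x₂ * (x₁ + β₁ - 1) - a ^ 2 - y)
              * contDualHahn x₂ y a b (e - p + x₁ - x₂)
            - x₁ * x₂ * (x₁ + β₁ - 1) * (x₂ + β₂ - 1)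
              * contDualHahn (x₂ - 1) y a b (e - p + x₁ - x₂) := by
        rw [hr, ← hab, show (p : ℂ) = a + e - 1 by linear_combination -hae,
          show β₁ = b + e - p by linear_combination -hbe,
          show (p : ℂ) = a + e - 1 by linear_combination -hae]
        ring
      rw [c1, c2, hv, sub_mul]
      have h := ((hM.sub hL).sub hP).congr_fun fun n =>
        bilinTerm_succ h₁ h₂ hc₀ hab hae hbe x₁ x₂ n
      rwa [mul_zero, sub_zero, ← mul_assoc, ← mul_assoc _ (contDualHahn (x₂ - 1) _ _ _ _)] at h

end BilinearMeixner

theorem theorem3p5 (k₁ k₂ c : ℝ) (hk₁ : 0 < k₁) (hk : k₁ ≤ k₂) (hc₀ : 0 < c) (hc₁ : c < 1)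
    (x₁ x₂ : ℕ) (p : ℤ) (y s : ℂ) (hs : s ^ 2 = y) :
    -- `s` is a square root of `y`; for `n + p < 0` the coefficient `C_n` is zero
    HasSum
      (fun n : ℕ =>
        BilinearMeixner.coeffC k₁ k₂ c x₁ x₂ p n
          * BilinearMeixner.contDualHahn n y
              (k₂ - k₁ + 1 / 2) (k₁ + k₂ - 1 / 2) (k₁ - k₂ + p + 1 / 2)
          * BilinearMeixner.meixner ((n : ℤ) + p).toNat x₁ (2 * k₁) c
          * BilinearMeixner.meixner n x₂ (2 * k₂) c)
      (BilinearMeixner.contDualHahn x₂ y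
          (k₂ - k₁ + 1 / 2) (k₁ + k₂ - 1 / 2) (k₁ - k₂ + x₁ - x₂ + 1 / 2)
        * BilinearMeixner.hypReg
            (p + k₁ - k₂ + 1 / 2 + Complex.I * s) (p + k₁ - k₂ + 1 / 2 - Complex.I * s)
            (p + x₂ - x₁ + 1) (c / (c - 1))) := by
  have h₁ : 0 < (2 * k₁ : ℂ).re := by simpa using hk₁
  have h₂ : 0 < (2 * k₂ : ℂ).re := by simpa using hk₁.trans_le hk
  have hcn : ‖(c : ℂ)‖ < 1 := by rwa [Complex.norm_real, Real.norm_of_nonneg hc₀.le]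
  have h := BilinearMeixner.hasSum_bilinTerm (y := y) (a := k₂ - k₁ + 1 / 2)
    (b := k₁ + k₂ - 1 / 2) (e := k₁ - k₂ + p + 1 / 2) (p := p) h₁ h₂
    (Complex.ofReal_ne_zero.2 hc₀.ne') hcn (by ring) (by ring) (by ring) x₂ x₁
  have hG := BilinearMeixner.hypReg_eq_tsum_genCoeff ((k₂ : ℂ) - k₁ + 1 / 2 + x₂ - x₁)
    (k₁ + k₂ - 1 / 2) (k₁ - k₂ + p + 1 / 2) s hc₀ hc₁
  have hp : ((((1 - c) ^ (2 * k₁ + (p : ℝ)) : ℝ)) : ℂ) = (1 - (c : ℂ)) ^ (2 * (k₁ : ℂ) + p) := by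
    rw [Complex.ofReal_cpow (by linarith)]
    push_cast
    rfl
  rw [show (p : ℂ) + k₁ - k₂ + 1 / 2 = k₁ - k₂ + p + 1 / 2 by ring,
    show (p : ℂ) + x₂ - x₁ + 1 = k₂ - k₁ + 1 / 2 + x₂ - x₁ + (k₁ - k₂ + p + 1 / 2) by ring, hG, hs,
    show (k₁ : ℂ) - k₂ + x₁ - x₂ + 1 / 2 = k₁ - k₂ + p + 1 / 2 - p + x₁ - x₂ by ring,
    show (k₁ : ℂ) + k₂ - 1 / 2 + (k₁ - k₂ + p + 1 / 2) = 2 * k₁ + p by ring, mul_left_comm]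
  refine (h.mul_left _).congr_fun fun n => ?_
  rw [BilinearMeixner.coeffC, BilinearMeixner.bilinTerm, BilinearMeixner.genCoeff,
    BilinearMeixner.weight, hp, Complex.Gamma_nat_eq_factorial, pow_add (c : ℂ),
    show (k₂ : ℂ) - k₁ + 1 / 2 + (k₁ - k₂ + p + 1 / 2) + n = n + p + 1 by ring]
  rw [div_eq_mul_inv, mul_inv]
  ring
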